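/- **Corollary C.** Let $k$ be a field, $D=\operatorname{Hom}_k(-,k)$, and let $n\ge 3$ be an integer. Let $\mathcal T$ be a $k$-linear triangulated category with shift functor $\Sigma$, let $\mathcal T^{fd}\subseteq\mathcal T$ be a (full) triangulated subcategory, let $M\in\mathcal T$, and let $\mathcal M=\operatorname{add}(M)$ be the full subcategory of direct summands of finite direct sums of copies of $M$. Assume that $(\mathcal T,\mathcal T^{fd},\mathcal M)$ is an $n$-Calabi-Yau triple, that is: 1. $\mathcal T$ is Hom-finite (all Hom-spaces are finite-dimensional over $k$) and Krull-Schmidt (every object is a finite direct sum of objects with local endomorphism rings); 2. there is a $k$-linear isomorphism $D\operatorname{Hom}_{\mathcal T}(X,Y)\cong\operatorname{Hom}_{\mathcal T}(Y,\Sigma^nX)$, natural in $X\in\mathcal T^{fd}$ and $Y\in\mathcal T$; 3. $\mathcal M$ is silting, i.e. $\operatorname{Hom}_{\mathcal T}(\mathcal M,\Sigma^i\mathcal M)=0$ for all $i>0$ and the smallest triangulated subcategory of $\mathcal T$ that is closed under direct summands and contains $\mathcal M$ is $\mathcal T$; moreover the pair $$(\mathcal T^{\le 0},\mathcal T^{\ge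 0})=\bigl(\{X\mid \operatorname{Hom}_{\mathcal T}(\Sigma^i\mathcal M,X)=0\ \forall i<0\},\ \{X\mid \operatorname{Hom}_{\mathcal T}(\Sigma^i\mathcal M,X)=0\ \forall i>0\}\bigr)$$ is a $t$-structure on $\mathcal T$, and $\mathcal T^{\ge 0}\subseteq\mathcal T^{fd}$. Let $Q:\mathcal T\to\mathcal T/\mathcal T^{fd}$ be the Verdier quotient functor. Then: (a) $\mathcal T/\mathcal T^{fd}$ is Hom-finite and $(n-1)$-Calabi-Yau, i.e. there is a $k$-linear isomorphism $D\operatorname{Hom}_{\mathcal T/\mathcal T^{fd}}(X,Y)\cong\operatorname{Hom}_{\mathcal T/\mathcal T^{fd}}(Y,\Sigma^{n-1}X)$, natural in $X,Y\in\mathcal T/\mathcal T^{fd}$. (b) The object $M$ (that is, $QM$) is $(n-1)$-cluster tilting in $\mathcal T/\mathcal T^{fd}$: writing $\mathcal C=\operatorname{add}(QM)\subseteq\mathcal T/\mathcal T^{fd}$, the subcategory $\mathcal C$ is functorially finite (every object has a right and a left $\mathcal C$-approximation) and $$\mathcal C=\{X\mid \operatorname{Hom}(\mathcal C,\Sigma^iX)=0,\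 1\le i\le n-2\}=\{X\mid \operatorname{Hom}(X,\Sigma^i\mathcal C)=0,\ 1\le i\le n-2\},$$ with Hom-spaces taken in $\mathcal T/\mathcal T^{fd}$. (c) The quotient functor induces an isomorphism of $k$-algebras $\operatorname{Hom}_{\mathcal T}(M,M)\cong\operatorname{Hom}_{\mathcal T/\mathcal T^{fd}}(M,M)$. -/

import Mathlib

open CategoryTheory CategoryTheory.Limits CategoryTheory.Pretriangulated

namespace CYTriple

section Linear

variable (k : Type*) [Field k] (C : Type*) [Category* C] [Preadditive C] [Linear k C]

/-- A `k`-linear category is Hom-finite if all its Hom-spaces are finite-dimensional. -/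
def HomFinite : Prop :=
  ∀ X Y : C, Module.Finite k (X ⟶ Y)

end Linear

section Additive

variable (C : Type*) [Category* C] [Preadditive C] [HasFiniteBiproducts C]

/-- An additive category is Krull-Schmidt if every object is a finite direct sum of objects with
local endomorphism rings. -/
def KrullSchmidt : Prop :=
  ∀ X : C, ∃ (m : ℕ) (F : Fin m → C),
    (∀ i, IsLocalRing (End (F i))) ∧ Nonempty (X ≅ ⨁ F)

variable {C}

/-- `add M`: the direct summands of finite direct sums of copies of `M`. -/
def add (M : C) : ObjectProperty C :=
  fun X => ∃ m : ℕ, Nonempty (Retract X (⨁ fun _ : Fin m => M))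

end Additive

section Approximations

variable {C : Type*} [Category* C]

/-- `α : A ⟶ X` is an `𝓐`-precover of `X`. -/
def IsPrecover (𝓐 : ObjectProperty C) {A X : C} (α : A ⟶ X) : Prop :=
  𝓐 A ∧ ∀ (A' : C), 𝓐 A' → ∀ α' : A' ⟶ X, ∃ β : A' ⟶ A, β ≫ α = α'

/-- `α : X ⟶ A` is an `𝓐`-preenvelope of `X`. -/
def IsPreenvelope (𝓐 : ObjectProperty C) {X A : C} (α : X ⟶ A) : Prop :=
  𝓐 A ∧ ∀ (A' : C), 𝓐 A' → ∀ α' : X ⟶ A', ∃ β : A ⟶ A', α ≫ β = α'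

/-- `𝓐` is functorially finite: it is both precovering and preenveloping. -/
def FunctoriallyFinite (𝓐 : ObjectProperty C) : Prop :=
  (∀ X : C, ∃ (A : C) (α : A ⟶ X), IsPrecover 𝓐 α) ∧
    ∀ X : C, ∃ (A : C) (α : X ⟶ A), IsPreenvelope 𝓐 α

end Approximations

section Shift

variable {C : Type*} [Category* C] [Preadditive C] [HasShift C ℤ]

/-- The objects `Σ^i X` with `i ∈ I` and `X ∈ 𝓜`, up to isomorphism; for instance
`Σ^{<0} 𝓜` is `shifts 𝓜 (Set.Iio 0)`. -/
def shifts (𝓜 : ObjectProperty C) (I : Set ℤ) : ObjectProperty C :=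
  fun Y => ∃ i ∈ I, ∃ X : C, 𝓜 X ∧ Nonempty (Y ≅ X⟦i⟧)

/-- `𝓟` is presilting: `Hom(𝓟, Σ^i 𝓟) = 0` for all `i > 0`. -/
def IsPresilting (𝓟 : ObjectProperty C) : Prop :=
  ∀ (i : ℤ), 0 < i → ∀ (X Y : C), 𝓟 X → 𝓟 Y → ∀ f : X ⟶ Y⟦i⟧, f = 0

/-- `𝓒` is a `d`-cluster tilting subcategory. -/
structure IsClusterTilting (d : ℤ) (𝓒 : ObjectProperty C) : Prop where
  functoriallyFinite : FunctoriallyFinite 𝓒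
  mem_iff_right : ∀ X : C, 𝓒 X ↔
    ∀ i : ℤ, 1 ≤ i → i ≤ d - 1 → ∀ Y : C, 𝓒 Y → ∀ f : Y ⟶ X⟦i⟧, f = 0
  mem_iff_left : ∀ X : C, 𝓒 X ↔
    ∀ i : ℤ, 1 ≤ i → i ≤ d - 1 → ∀ Y : C, 𝓒 Y → ∀ f : X ⟶ Y⟦i⟧, f = 0

/-- An object `M` is `d`-cluster tilting if `add M` is a `d`-cluster tilting subcategory. -/
def IsClusterTiltingObject [HasFiniteBiproducts C] (d : ℤ) (M : C) : Prop :=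
  IsClusterTilting d (add M)

variable (k : Type*) [Field k] [Linear k C]

/-- There is an isomorphism `D Hom(X, Y) ≅ Hom(Y, Σ^d X)` of `k`-vector spaces for `X ∈ 𝓢` and
`Y ∈ C`, natural in both variables. Here `D = Hom_k(-, k)`, and the equation states naturality
with respect to `f : X ⟶ X'` in the full subcategory `𝓢` and `g : Y' ⟶ Y` in `C`: the functional
on the left-hand side is `ψ ↦ φ (f ≫ ψ ≫ g)`. -/
def RelativeCalabiYau (𝓢 : ObjectProperty C) (d : ℤ) : Prop :=
  ∃ e : ∀ (X Y : C), 𝓢 X → (Module.Dual k (X ⟶ Y) ≃ₗ[k] (Y ⟶ X⟦d⟧)),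
    ∀ (X X' Y Y' : C) (hX : 𝓢 X) (hX' : 𝓢 X') (f : X ⟶ X') (g : Y' ⟶ Y)
      (φ : Module.Dual k (X ⟶ Y)),
      e X' Y' hX' (φ ∘ₗ Linear.leftComp k Y f ∘ₗ Linear.rightComp k X' g) =
        g ≫ e X Y hX φ ≫ f⟦d⟧'

variable (C) in
/-- The `k`-linear category `C` with shift is `d`-Calabi-Yau: there is an isomorphism
`D Hom(X, Y) ≅ Hom(Y, Σ^d X)`, natural in `X, Y ∈ C`. -/
def CalabiYau (d : ℤ) : Prop :=
  RelativeCalabiYau k (⊤ : ObjectProperty C) d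

end Shift

section Triangulated

variable {C : Type*} [Category* C] [HasZeroObject C] [HasShift C ℤ] [Preadditive C]
  [∀ i : ℤ, (shiftFunctor C i).Additive] [Pretriangulated C]

/-- `𝓟` is silting: it is presilting, and the smallest triangulated subcategory of `C` which is
closed under direct summands and contains `𝓟` is `C`. -/
def IsSilting (𝓟 : ObjectProperty C) : Prop :=
  IsPresilting 𝓟 ∧ 𝓟.triangEnvelope = ⊤

/-- `(C, Tfd, 𝓜)` is an `n`-Calabi-Yau triple. -/
structure IsCalabiYauTriple (k : Type*) [Field k] [Linear k C] (n : ℤ)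
    (Tfd : ObjectProperty C) [Tfd.IsTriangulated] (𝓜 : ObjectProperty C) : Prop where
  additive : 𝓜.IsClosedUnderFiniteProducts
  homFinite : HomFinite k C
  krullSchmidt : KrullSchmidt C
  relativeCalabiYau : RelativeCalabiYau k Tfd n
  silting : IsSilting 𝓜
  adjacent_tStructure : ∃ t : Triangulated.TStructure C,
    t.le 0 = (shifts 𝓜 (Set.Iio 0)).rightOrthogonal ∧
    t.ge 0 = (shifts 𝓜 (Set.Ioi 0)).rightOrthogonal ∧
    t.ge 0 ≤ Tfd

/-- The Verdier quotient `C / 𝓢`: the localization of `C` at the morphisms whose cone lies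
in `𝓢`. -/
abbrev VerdierQuotient (𝓢 : ObjectProperty C) : Type _ :=
  𝓢.trW.Localization

/-- The quotient functor `C ⥤ C / 𝓢`. -/
abbrev quotientFunctor (𝓢 : ObjectProperty C) : C ⥤ VerdierQuotient 𝓢 :=
  𝓢.trW.Q

end Triangulated

end CYTriple

/-! Duality on `Tfd` enters through traces. If the first leg of a roof `X ⟵ X' ⟶ X⟦n-1⟧` has cone
`Z` in `Tfd`, the composite `Z ⟶ X'⟦1⟧ ⟶ X⟦n⟧ ⟶ Z⟦n⟧` has a trace that depends only on the morphism
which the roof represents. This defines the degree `n - 1` trace on the quotient.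

The quotient is then compared with `T`. For `X` in `T^{≤ a}` and `Y` in `coGT t (a - n + 1)` the map
from `Hom_T(X, Y)` to the quotient is bijective (`map_injective`, `map_surjective`): the parts of
`X` cut off by truncation are bounded, and duality kills their maps to `Y` and `Y⟦1⟧`. Every `Y`
lies in some `coGT t c`, and every `X` may be truncated, so this range covers all objects. It yields
Hom-finiteness, nondegeneracy of the trace (`quotientTrace_left`, `quotientTrace_right`) and the
isomorphism of endomorphism algebras.

For cluster tilting, every object needs a representative `A` in `T^{≤ 0}` and `coGT t (1 - n)`. The
hard point is `exists_coGT_trW`: the cone of a coreflection into the heart raises the `coGT` bound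
by one. For such `A`, vanishing of `Hom(A, M⟦i⟧)` in the quotient lifts to `T`, and approximations
by sums of `M` raise the bound to `-1`, where `A` is a summand of a sum of copies of `M`. The other
orthogonality condition follows by the `(n-1)`-Calabi-Yau duality. -/

namespace CYTriple

/-! ### Calabi-Yau dualities as nondegenerate traces. -/

section TraceForm

variable {C : Type*} [Category* C] [Preadditive C] [HasShift C ℤ]
  (k : Type*) [Field k] [Linear k C]

/-- A family of traces `Hom(X, Σ^d X) → k`, symmetric and nondegenerate for `X ∈ 𝓢`; this is
equivalent to a natural isomorphism `D Hom(X, Y) ≅ Hom(Y, Σ^d X)` for `X ∈ 𝓢` and `Y ∈ C` when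
`C` is Hom-finite. -/
structure TraceForm (𝓢 : ObjectProperty C) (d : ℤ) where
  tr : ∀ X : C, (X ⟶ X⟦d⟧) →ₗ[k] k
  tr_comm : ∀ {X Y : C}, 𝓢 X → 𝓢 Y → ∀ (f : X ⟶ Y) (g : Y ⟶ X⟦d⟧),
    tr X (f ≫ g) = tr Y (g ≫ f⟦d⟧')
  eq_zero_of_left : ∀ {X Y : C}, 𝓢 X → ∀ f : X ⟶ Y,
    (∀ g : Y ⟶ X⟦d⟧, tr X (f ≫ g) = 0) → f = 0
  eq_zero_of_right : ∀ {X Y : C}, 𝓢 X → ∀ g : Y ⟶ X⟦d⟧,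
    (∀ f : X ⟶ Y, tr X (f ≫ g) = 0) → g = 0

variable {k}

open Classical in
lemma RelativeCalabiYau.nonempty_traceForm {𝓢 : ObjectProperty C} {d : ℤ}
    (h : RelativeCalabiYau k 𝓢 d) : Nonempty (TraceForm k 𝓢 d) := by
  obtain ⟨e, he⟩ := h
  let tr : ∀ X : C, (X ⟶ X⟦d⟧) →ₗ[k] k := fun X =>
    if hX : 𝓢 X then (e X (X⟦d⟧) hX).symm (𝟙 _) else 0
  have key : ∀ {X Y : C} (hX : 𝓢 X) (f : X ⟶ Y) (g : Y ⟶ X⟦d⟧),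
      tr X (f ≫ g) = (e X Y hX).symm g f := by
    intro X Y hX f g
    have h₁ := he X X (X⟦d⟧) Y hX hX (𝟙 X) g (tr X)
    simp only [tr, dif_pos hX, LinearEquiv.apply_symm_apply,
      CategoryTheory.Functor.map_id, Category.comp_id] at h₁
    have h₂ := congrArg (fun φ => φ f) ((LinearEquiv.eq_symm_apply _).2 h₁)
    simpa [tr, dif_pos hX] using h₂
  refine ⟨⟨tr, ?_, ?_, ?_⟩⟩
  · intro X Y hX hY f g
    have h₁ := he X Y Y Y hX hY f (𝟙 Y) ((e X Y hX).symm g)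
    simp only [LinearEquiv.apply_symm_apply, Category.id_comp] at h₁
    have h₂ := congrArg (fun φ => φ (𝟙 Y)) ((LinearEquiv.eq_symm_apply _).2 h₁)
    rw [key hX]
    have h₃ := key hY (𝟙 Y) (g ≫ f⟦d⟧')
    rw [Category.id_comp] at h₃
    rw [h₃]
    simpa using h₂
  · intro X Y hX f hf
    rw [← Module.forall_dual_apply_eq_zero_iff k]
    intro φ
    simpa [key hX] using hf (e X Y hX φ)
  · intro X Y hX g hg
    rw [← (e X Y hX).symm.map_eq_zero_iff]
    ext f
    simpa [key hX] using hg f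

/-- For finite-dimensional Hom-spaces, a pairing that is injective on both sides is perfect. -/
lemma TraceForm.calabiYau {d : ℤ} (τ : TraceForm k (⊤ : ObjectProperty C) d)
    (hC : HomFinite k C) : CalabiYau C k d := by
  let B : ∀ X Y : C, (Y ⟶ X⟦d⟧) →ₗ[k] Module.Dual k (X ⟶ Y) := fun X Y =>
    LinearMap.mk₂ k (fun g f => τ.tr X (f ≫ g)) (by simp) (by simp) (by simp) (by simp)
  have hB : ∀ X Y g f, B X Y g f = τ.tr X (f ≫ g) := fun _ _ _ _ => rfl
  have bij : ∀ X Y, Function.Bijective (B X Y) := by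
    intro X Y
    have := hC X Y
    have := hC Y (X⟦d⟧)
    have h₁ : Function.Injective (B X Y) := by
      rw [injective_iff_map_eq_zero]
      intro g hg
      exact τ.eq_zero_of_right trivial g (fun f => by rw [← hB, hg]; rfl)
    have h₂ : Function.Injective (B X Y).flip := by
      rw [injective_iff_map_eq_zero]
      intro f hf
      exact τ.eq_zero_of_left trivial f (fun g => by
        rw [← hB]; exact congrArg (fun φ => φ g) hf)
    exact (LinearMap.IsPerfPair.of_injective h₁ h₂).bijective_left
  let E : ∀ X Y : C, (Y ⟶ X⟦d⟧) ≃ₗ[k] Module.Dual k (X ⟶ Y) := fun X Y =>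
    LinearEquiv.ofBijective (B X Y) (bij X Y)
  refine ⟨fun X Y _ => (E X Y).symm, ?_⟩
  intro X X' Y Y' _ _ f g φ
  rw [LinearEquiv.symm_apply_eq]
  obtain ⟨p, rfl⟩ := (E X Y).surjective φ
  ext ψ
  change τ.tr X ((f ≫ ψ ≫ g) ≫ p) = τ.tr X' (ψ ≫ g ≫ (E X Y).symm (E X Y p) ≫ f⟦d⟧')
  rw [LinearEquiv.symm_apply_apply]
  have := τ.tr_comm (X := X) (Y := X') trivial trivial f (ψ ≫ g ≫ p)
  simpa using this

end TraceForm

end CYTriple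

namespace CYTriple

/-! ### The trace on the Verdier quotient. -/

section QuotientTrace

variable {k : Type*} [Field k] {C : Type*} [Category* C] [HasZeroObject C] [HasShift C ℤ]
  [Preadditive C] [Linear k C] [∀ i : ℤ, (shiftFunctor C i).Additive]
  [∀ i : ℤ, (shiftFunctor C i).Linear k] [Pretriangulated C]
  {𝓢 : ObjectProperty C} {n : ℤ} (τ : TraceForm k 𝓢 n) {d : ℤ} (hd : d + 1 = n)

/-- The trace of the endomorphism of degree `d` in the Verdier quotient given by a roof
`X ⟵ X' ⟶ X⟦d⟧`, where the first leg has cone `Z`. -/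
noncomputable def roofTrace {X' X Z : C} (c : X ⟶ Z) (w : Z ⟶ X'⟦(1 : ℤ)⟧) :
    (X' ⟶ X⟦d⟧) →ₗ[k] k :=
  τ.tr Z ∘ₗ
    { toFun := fun g => w ≫ g⟦(1 : ℤ)⟧' ≫ (shiftFunctorAdd' C d 1 n hd).inv.app X ≫ c⟦n⟧'
      map_add' := by simp [Functor.map_add]
      map_smul' := by simp [Functor.map_smul] }

omit [HasZeroObject C] [Pretriangulated C] in
lemma roofTrace_apply {X' X Z : C} (c : X ⟶ Z) (w : Z ⟶ X'⟦(1 : ℤ)⟧) (g : X' ⟶ X⟦d⟧) :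
    roofTrace τ hd c w g = τ.tr Z (w ≫ g⟦(1 : ℤ)⟧' ≫
      (shiftFunctorAdd' C d 1 n hd).inv.app X ≫ c⟦n⟧') := rfl

/-- Complete `f'` and `f` to a morphism of triangles; its component `Z ⟶ Z'` lies in `𝓢`, where
symmetry of `τ` applies. The case `f = 𝟙 X` gives invariance under refining a roof. -/
lemma roofTrace_comm {X' X Z Y' Y Z' : C} {s : X' ⟶ X} {c : X ⟶ Z} {w : Z ⟶ X'⟦(1 : ℤ)⟧}
    (hT : Triangle.mk s c w ∈ distTriang C) (hZ : 𝓢 Z)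
    {s' : Y' ⟶ Y} {c' : Y ⟶ Z'} {w' : Z' ⟶ Y'⟦(1 : ℤ)⟧}
    (hT' : Triangle.mk s' c' w' ∈ distTriang C) (hZ' : 𝓢 Z')
    (f : X ⟶ Y) (f' : X' ⟶ Y') (hf : s ≫ f = f' ≫ s') (g : Y' ⟶ X⟦d⟧) :
    roofTrace τ hd c w (f' ≫ g) = roofTrace τ hd c' w' (g ≫ f⟦d⟧') := by
  obtain ⟨f'' : Z ⟶ Z', h₁ : c ≫ f'' = f ≫ c', h₂ : w ≫ f'⟦(1 : ℤ)⟧' = f'' ≫ w'⟩ :=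
    complete_distinguished_triangle_morphism _ _ hT hT' f' f hf
  simp only [roofTrace_apply, Functor.map_comp]
  rw [Category.assoc, reassoc_of% h₂, τ.tr_comm hZ hZ']
  have nat := (shiftFunctorAdd' C d 1 n hd).inv.naturality_assoc f (c'⟦n⟧')
  simp only [Category.assoc]
  rw [← (shiftFunctor C n).map_comp c f'', h₁, (shiftFunctor C n).map_comp]
  exact congrArg (fun q => τ.tr Z' (w' ≫ g⟦(1 : ℤ)⟧' ≫ q)) nat.symm

variable [IsTriangulated C] [𝓢.IsTriangulated]

lemma exists_right_ore {X Y Y' : C} (f : X ⟶ Y) (s : Y' ⟶ Y) (hs : 𝓢.trW s) :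
    ∃ (X' : C) (s' : X' ⟶ X) (f' : X' ⟶ Y'), 𝓢.trW s' ∧ s' ≫ f = f' ≫ s := by
  obtain ⟨ψ, hψ⟩ := (MorphismProperty.LeftFraction.mk f s hs).exists_rightFraction
  exact ⟨_, ψ.s, ψ.f, ψ.hs, hψ⟩

lemma exists_roof {X Y : C}
    (φ : (quotientFunctor 𝓢).obj X ⟶ (quotientFunctor 𝓢).obj Y) :
    ∃ (X' : C) (s : X' ⟶ X) (g : X' ⟶ Y), 𝓢.trW s ∧
      (quotientFunctor 𝓢).map g = (quotientFunctor 𝓢).map s ≫ φ := by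
  obtain ⟨ψ, rfl⟩ := Localization.exists_rightFraction (quotientFunctor 𝓢) 𝓢.trW φ
  exact ⟨_, ψ.s, ψ.f, ψ.hs, by simp⟩

omit [IsTriangulated C] [𝓢.IsTriangulated] in
lemma isIso_map_quotientFunctor {X Y : C} (s : X ⟶ Y) (hs : 𝓢.trW s) :
    IsIso ((quotientFunctor 𝓢).map s) :=
  Localization.inverts _ 𝓢.trW s hs

/-- `v` is the trace of `h`, computed with some roof representing `h`. -/
def IsRoofTrace {X : C} (h : (quotientFunctor 𝓢).obj X ⟶ ((quotientFunctor 𝓢).obj X)⟦d⟧)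
    (v : k) : Prop :=
  ∃ (X' Z : C) (s : X' ⟶ X) (c : X ⟶ Z) (w : Z ⟶ X'⟦(1 : ℤ)⟧) (g : X' ⟶ X⟦d⟧),
    Triangle.mk s c w ∈ distTriang C ∧ 𝓢 Z ∧
    (quotientFunctor 𝓢).map g ≫ ((quotientFunctor 𝓢).commShiftIso d).hom.app X =
      (quotientFunctor 𝓢).map s ≫ h ∧ roofTrace τ hd c w g = v

variable {τ hd}

lemma IsRoofTrace.unique {X : C}
    {h : (quotientFunctor 𝓢).obj X ⟶ ((quotientFunctor 𝓢).obj X)⟦d⟧} {v v' : k}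
    (hv : IsRoofTrace τ hd h v) (hv' : IsRoofTrace τ hd h v') : v = v' := by
  obtain ⟨X₁, Z₁, s₁, c₁, w₁, g₁, hT₁, hZ₁, hg₁, rfl⟩ := hv
  obtain ⟨X₂, Z₂, s₂, c₂, w₂, g₂, hT₂, hZ₂, hg₂, rfl⟩ := hv'
  have hs₁ : 𝓢.trW s₁ := ⟨_, _, _, hT₁, hZ₁⟩
  have hs₂ : 𝓢.trW s₂ := ⟨_, _, _, hT₂, hZ₂⟩
  obtain ⟨X₃, a, b, ha, hab⟩ := exists_right_ore s₁ s₂ hs₂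
  have : (quotientFunctor 𝓢).map (a ≫ g₁) = (quotientFunctor 𝓢).map (b ≫ g₂) := by
    rw [← cancel_mono (((quotientFunctor 𝓢).commShiftIso d).hom.app X)]
    simp only [Functor.map_comp, Category.assoc, hg₁, hg₂]
    simp only [← Functor.map_comp_assoc, hab]
  rw [MorphismProperty.map_eq_iff_precomp (quotientFunctor 𝓢) 𝓢.trW] at this
  obtain ⟨X₄, r, hr, hr'⟩ := this
  obtain ⟨Z₄, c₄, w₄, hT₄, hZ₄⟩ : 𝓢.trW (r ≫ a ≫ s₁) :=
    𝓢.trW.comp_mem _ _ hr (𝓢.trW.comp_mem _ _ ha hs₁)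
  have e₁ := roofTrace_comm τ hd hT₄ hZ₄ hT₁ hZ₁ (𝟙 X) (r ≫ a) (by simp) g₁
  have e₂ := roofTrace_comm τ hd hT₄ hZ₄ hT₂ hZ₂ (𝟙 X) (r ≫ b) (by simp [hab]) g₂
  rw [CategoryTheory.Functor.map_id, Category.comp_id] at e₁ e₂
  rw [← e₁, ← e₂, Category.assoc, Category.assoc, hr']

variable (τ hd)

lemma exists_isRoofTrace {X : C}
    (h : (quotientFunctor 𝓢).obj X ⟶ ((quotientFunctor 𝓢).obj X)⟦d⟧) :
    ∃ v, IsRoofTrace τ hd h v := by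
  obtain ⟨X', s, g, ⟨Z, c, w, hT, hZ⟩, hg⟩ := exists_roof
    (h ≫ ((quotientFunctor 𝓢).commShiftIso d).inv.app X)
  exact ⟨_, X', Z, s, c, w, g, hT, hZ, by simp [hg], rfl⟩

variable {τ hd}

lemma IsRoofTrace.add {X : C}
    {h₁ h₂ : (quotientFunctor 𝓢).obj X ⟶ ((quotientFunctor 𝓢).obj X)⟦d⟧} {v₁ v₂ : k}
    (hv₁ : IsRoofTrace τ hd h₁ v₁) (hv₂ : IsRoofTrace τ hd h₂ v₂) :
    IsRoofTrace τ hd (h₁ + h₂) (v₁ + v₂) := by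
  obtain ⟨X₁, Z₁, s₁, c₁, w₁, g₁, hT₁, hZ₁, hg₁, rfl⟩ := hv₁
  obtain ⟨X₂, Z₂, s₂, c₂, w₂, g₂, hT₂, hZ₂, hg₂, rfl⟩ := hv₂
  have hs₁ : 𝓢.trW s₁ := ⟨_, _, _, hT₁, hZ₁⟩
  have hs₂ : 𝓢.trW s₂ := ⟨_, _, _, hT₂, hZ₂⟩
  obtain ⟨X₃, a, b, ha, hab⟩ := exists_right_ore s₁ s₂ hs₂
  obtain ⟨Z₃, c₃, w₃, hT₃, hZ₃⟩ : 𝓢.trW (a ≫ s₁) := 𝓢.trW.comp_mem _ _ ha hs₁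
  have e₁ := roofTrace_comm τ hd hT₃ hZ₃ hT₁ hZ₁ (𝟙 X) a (by simp) g₁
  have e₂ := roofTrace_comm τ hd hT₃ hZ₃ hT₂ hZ₂ (𝟙 X) b (by simp [hab]) g₂
  rw [CategoryTheory.Functor.map_id, Category.comp_id] at e₁ e₂
  refine ⟨X₃, Z₃, a ≫ s₁, c₃, w₃, a ≫ g₁ + b ≫ g₂, hT₃, hZ₃, ?_, ?_⟩
  · simp only [Functor.map_add, Functor.map_comp, Preadditive.add_comp, Category.assoc, hg₁, hg₂,
      Preadditive.comp_add]
    simp only [← Functor.map_comp_assoc, hab]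
  · rw [map_add, e₁, e₂]

lemma IsRoofTrace.smul {X : C}
    {h : (quotientFunctor 𝓢).obj X ⟶ ((quotientFunctor 𝓢).obj X)⟦d⟧} {v : k}
    (hv : IsRoofTrace τ hd h v) (a : k) : IsRoofTrace τ hd (a • h) (a • v) := by
  obtain ⟨X₁, Z₁, s₁, c₁, w₁, g₁, hT₁, hZ₁, hg₁, rfl⟩ := hv
  refine ⟨X₁, Z₁, s₁, c₁, w₁, a • g₁, hT₁, hZ₁, ?_, by simp⟩
  rw [Functor.map_smul, Linear.smul_comp, hg₁, Linear.comp_smul]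

variable (τ hd)

/-- The trace on endomorphisms of degree `d` in the Verdier quotient. -/
noncomputable def quotientTrace (X : C) :
    ((quotientFunctor 𝓢).obj X ⟶ ((quotientFunctor 𝓢).obj X)⟦d⟧) →ₗ[k] k where
  toFun h := (exists_isRoofTrace τ hd h).choose
  map_add' h₁ h₂ := (exists_isRoofTrace τ hd (h₁ + h₂)).choose_spec.unique
    ((exists_isRoofTrace τ hd h₁).choose_spec.add (exists_isRoofTrace τ hd h₂).choose_spec)
  map_smul' a h := (exists_isRoofTrace τ hd (a • h)).choose_spec.unique
    ((exists_isRoofTrace τ hd h).choose_spec.smul a)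

lemma isRoofTrace_quotientTrace {X : C}
    (h : (quotientFunctor 𝓢).obj X ⟶ ((quotientFunctor 𝓢).obj X)⟦d⟧) :
    IsRoofTrace τ hd h (quotientTrace τ hd X h) :=
  (exists_isRoofTrace τ hd h).choose_spec

lemma quotientTrace_eq {X X' Z : C}
    (h : (quotientFunctor 𝓢).obj X ⟶ ((quotientFunctor 𝓢).obj X)⟦d⟧)
    {s : X' ⟶ X} {c : X ⟶ Z} {w : Z ⟶ X'⟦(1 : ℤ)⟧} (g : X' ⟶ X⟦d⟧)
    (hT : Triangle.mk s c w ∈ distTriang C) (hZ : 𝓢 Z)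
    (hg : (quotientFunctor 𝓢).map g ≫ ((quotientFunctor 𝓢).commShiftIso d).hom.app X =
      (quotientFunctor 𝓢).map s ≫ h) :
    quotientTrace τ hd X h = roofTrace τ hd c w g :=
  (isRoofTrace_quotientTrace τ hd h).unique ⟨X', Z, s, c, w, g, hT, hZ, hg, rfl⟩

lemma quotientTrace_comm_map {X Y : C} (f : X ⟶ Y)
    (g : (quotientFunctor 𝓢).obj Y ⟶ ((quotientFunctor 𝓢).obj X)⟦d⟧) :
    quotientTrace τ hd X ((quotientFunctor 𝓢).map f ≫ g) =
      quotientTrace τ hd Y (g ≫ ((quotientFunctor 𝓢).map f)⟦d⟧') := by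
  obtain ⟨Y', s, g', hs, hg'⟩ := exists_roof
    (g ≫ ((quotientFunctor 𝓢).commShiftIso d).inv.app X)
  obtain ⟨X', s', f', hs', hf'⟩ := exists_right_ore f s hs
  obtain ⟨Z, c, w, hT, hZ⟩ := hs
  obtain ⟨Z', c', w', hT', hZ'⟩ := hs'
  have hg : (quotientFunctor 𝓢).map g' ≫ ((quotientFunctor 𝓢).commShiftIso d).hom.app X =
      (quotientFunctor 𝓢).map s ≫ g := by simp [hg']
  rw [quotientTrace_eq τ hd _ (f' ≫ g') hT' hZ', quotientTrace_eq τ hd _ (g' ≫ f⟦d⟧') hT hZ,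
    roofTrace_comm τ hd hT' hZ' hT hZ f f' hf']
  · rw [Functor.map_comp, Category.assoc, Functor.commShiftIso_hom_naturality, reassoc_of% hg]
  · rw [Functor.map_comp, Category.assoc, hg, ← Functor.map_comp_assoc, ← hf',
      Functor.map_comp_assoc]

lemma quotientTrace_comm {X Y : C}
    (f : (quotientFunctor 𝓢).obj X ⟶ (quotientFunctor 𝓢).obj Y)
    (g : (quotientFunctor 𝓢).obj Y ⟶ ((quotientFunctor 𝓢).obj X)⟦d⟧) :
    quotientTrace τ hd X (f ≫ g) = quotientTrace τ hd Y (g ≫ f⟦d⟧') := by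
  obtain ⟨X', s, f', hs, hf'⟩ := exists_roof f
  have := isIso_map_quotientFunctor s hs
  obtain rfl : f = inv ((quotientFunctor 𝓢).map s) ≫ (quotientFunctor 𝓢).map f' := by
    simp [hf']
  -- Moving `s` around the trace cancels its inverse, which leaves a composite with the image of
  -- `f'`.
  have h := quotientTrace_comm_map τ hd s
    (inv ((quotientFunctor 𝓢).map s) ≫ (quotientFunctor 𝓢).map f' ≫ g ≫
      (inv ((quotientFunctor 𝓢).map s))⟦d⟧')
  rw [IsIso.hom_inv_id_assoc] at h
  simp only [Category.assoc, ← Functor.map_comp, IsIso.inv_hom_id, CategoryTheory.Functor.map_id,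
    Category.comp_id] at h ⊢
  rw [← h, quotientTrace_comm_map]
  simp

end QuotientTrace

end CYTriple

namespace CYTriple

/-! ### Vanishing of Hom-spaces under shifts, summands and triangles. -/

section HomZero

variable {C : Type*} [Category* C] [Preadditive C]

/-- `Hom(X, Y) = 0`. -/
def HomZero (X Y : C) : Prop := ∀ f : X ⟶ Y, f = 0

lemma HomZero.of_iso {X X' Y Y' : C} (h : HomZero X Y) (e : X ≅ X') (e' : Y ≅ Y') :
    HomZero X' Y' := fun f => by
  rw [← cancel_epi e.hom, ← cancel_mono e'.inv]
  simpa using h (e.hom ≫ f ≫ e'.inv)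

lemma HomZero.of_retract {X X' Y : C} (h : HomZero X Y) (r : Retract X' X) :
    HomZero X' Y := fun f => by
  have := h (r.r ≫ f)
  rw [← Category.id_comp f, ← r.retract, Category.assoc, this, comp_zero]

lemma HomZero.of_retract_right {X Y Y' : C} (h : HomZero X Y) (r : Retract Y' Y) :
    HomZero X Y' := fun f => by
  have := h (f ≫ r.i)
  rw [← Category.comp_id f, ← r.retract, ← Category.assoc, this, zero_comp]

lemma HomZero.of_add [HasFiniteBiproducts C] {M A Y : C} (h : HomZero M Y) (hA : add M A) :
    HomZero A Y := by
  obtain ⟨m, ⟨r⟩⟩ := hA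
  refine HomZero.of_retract (fun f => ?_) r
  ext i
  simpa using h _

lemma HomZero.of_add_right [HasFiniteBiproducts C] {M A X : C} (h : HomZero X M)
    (hA : add M A) : HomZero X A := by
  obtain ⟨m, ⟨r⟩⟩ := hA
  refine HomZero.of_retract_right (fun f => ?_) r
  ext i
  simpa using h _

lemma add_self [HasFiniteBiproducts C] (M : C) : add M M :=
  ⟨1, ⟨{ i := biproduct.ι (fun _ : Fin 1 => M) 0, r := biproduct.π (fun _ : Fin 1 => M) 0 }⟩⟩

variable [HasShift C ℤ]

lemma homZero_shift_iff (X Y : C) {a b a' b' : ℤ} (h : b - a = b' - a') :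
    HomZero (X⟦a⟧) (Y⟦b⟧) ↔ HomZero (X⟦a'⟧) (Y⟦b'⟧) := by
  suffices ∀ {a b a' b' : ℤ}, b - a = b' - a' → HomZero (X⟦a⟧) (Y⟦b⟧) →
    HomZero (X⟦a'⟧) (Y⟦b'⟧) from ⟨this h, this h.symm⟩
  intro a b a' b' h H f
  have hf := H.of_iso ((shiftFunctorAdd' C a' (a - a') a (by lia)).app X)
    ((shiftFunctorAdd' C b' (a - a') b (by lia)).app Y) (f⟦a - a'⟧')
  exact (shiftFunctor C (a - a')).map_injective (by rw [hf, Functor.map_zero])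

lemma homZero_shift_left_iff (X Y : C) {a b : ℤ} (h : a + b = 0) :
    HomZero (X⟦a⟧) Y ↔ HomZero X (Y⟦b⟧) := by
  have e : HomZero (X⟦a⟧) (Y⟦(0 : ℤ)⟧) ↔ HomZero (X⟦(0 : ℤ)⟧) (Y⟦b⟧) :=
    homZero_shift_iff X Y (by lia)
  exact ⟨fun H => (e.1 (H.of_iso (Iso.refl _) ((shiftFunctorZero C ℤ).symm.app Y))).of_iso
      ((shiftFunctorZero C ℤ).app X) (Iso.refl _),
    fun H => (e.2 (H.of_iso ((shiftFunctorZero C ℤ).symm.app X) (Iso.refl _))).of_iso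
      (Iso.refl _) ((shiftFunctorZero C ℤ).app Y)⟩

lemma homZero_shift_shift_iff (X Y : C) (a : ℤ) :
    HomZero (X⟦a⟧) (Y⟦a⟧) ↔ HomZero X Y := by
  have e : HomZero (X⟦a⟧) (Y⟦a⟧) ↔ HomZero (X⟦(0 : ℤ)⟧) (Y⟦(0 : ℤ)⟧) :=
    homZero_shift_iff X Y (by lia)
  exact e.trans ⟨fun H => H.of_iso ((shiftFunctorZero C ℤ).app X) ((shiftFunctorZero C ℤ).app Y),
    fun H => H.of_iso ((shiftFunctorZero C ℤ).symm.app X) ((shiftFunctorZero C ℤ).symm.app Y)⟩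

end HomZero

section TriangleHomZero

variable {C : Type*} [Category* C] [HasZeroObject C] [HasShift C ℤ] [Preadditive C]
  [∀ i : ℤ, (shiftFunctor C i).Additive] [Pretriangulated C]
  {X Y Z : C} {f : X ⟶ Y} {g : Y ⟶ Z} {h : Z ⟶ X⟦(1 : ℤ)⟧}

lemma exists_lift_obj₁ (hT : Triangle.mk f g h ∈ distTriang C) {A : C} (φ : A ⟶ Y)
    (hφ : φ ≫ g = 0) : ∃ ψ : A ⟶ X, ψ ≫ f = φ := by
  obtain ⟨ψ, hψ⟩ := Triangle.coyoneda_exact₂ _ hT φ hφ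
  exact ⟨ψ, hψ.symm⟩

lemma exists_lift_obj₂ (hT : Triangle.mk f g h ∈ distTriang C) {A : C} (φ : A ⟶ Z)
    (hφ : φ ≫ h = 0) : ∃ ψ : A ⟶ Y, ψ ≫ g = φ := by
  obtain ⟨ψ, hψ⟩ := Triangle.coyoneda_exact₃ _ hT φ hφ
  exact ⟨ψ, hψ.symm⟩

lemma exists_desc_obj₃ (hT : Triangle.mk f g h ∈ distTriang C) {A : C} (φ : Y ⟶ A)
    (hφ : f ≫ φ = 0) : ∃ ψ : Z ⟶ A, g ≫ ψ = φ := by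
  obtain ⟨ψ, hψ⟩ := Triangle.yoneda_exact₂ _ hT φ hφ
  exact ⟨ψ, hψ.symm⟩

lemma exists_desc_shift_obj₁ (hT : Triangle.mk f g h ∈ distTriang C) {A : C} (φ : Z ⟶ A)
    (hφ : g ≫ φ = 0) : ∃ ψ : X⟦(1 : ℤ)⟧ ⟶ A, h ≫ ψ = φ := by
  obtain ⟨ψ, hψ⟩ := Triangle.yoneda_exact₃ _ hT φ hφ
  exact ⟨ψ, hψ.symm⟩

lemma exists_desc_obj₂ (hT : Triangle.mk f g h ∈ distTriang C) {A : C} (φ : X ⟶ A)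
    (hφ : h ≫ φ⟦(1 : ℤ)⟧' = 0) : ∃ ψ : Y ⟶ A, f ≫ ψ = φ := by
  obtain ⟨ψ : Y⟦(1 : ℤ)⟧ ⟶ A⟦(1 : ℤ)⟧, hψ : φ⟦(1 : ℤ)⟧' = (-f⟦(1 : ℤ)⟧') ≫ ψ⟩ :=
    Triangle.yoneda_exact₂ _ (rot_of_distTriang _ (rot_of_distTriang _ hT))
      (φ⟦(1 : ℤ)⟧') hφ
  obtain ⟨ψ', rfl⟩ := (shiftFunctor C (1 : ℤ)).map_surjective ψ
  refine ⟨-ψ', (shiftFunctor C (1 : ℤ)).map_injective ?_⟩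
  rw [hψ, Functor.map_comp, Functor.map_neg, Preadditive.comp_neg, Preadditive.neg_comp]

lemma HomZero.ext_right (hT : Triangle.mk f g h ∈ distTriang C) {A : C} (h₁ : HomZero A X)
    (h₃ : HomZero A Z) : HomZero A Y := fun φ => by
  obtain ⟨ψ, rfl⟩ := exists_lift_obj₁ hT φ (h₃ _)
  rw [h₁ ψ, zero_comp]

lemma HomZero.ext_left (hT : Triangle.mk f g h ∈ distTriang C) {A : C} (h₁ : HomZero X A)
    (h₃ : HomZero Z A) : HomZero Y A := fun φ => by
  obtain ⟨ψ, rfl⟩ := exists_desc_obj₃ hT φ (h₁ _)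
  rw [h₃ ψ, comp_zero]

end TriangleHomZero

/-! ### Left orthogonals of the aisles. -/

section TStructure

open Triangulated

variable {T : Type*} [Category* T] [HasZeroObject T] [HasShift T ℤ] [Preadditive T]
  [∀ i : ℤ, (shiftFunctor T i).Additive] [Pretriangulated T] (t : TStructure T)

lemma isLE_of_retract {X Y : T} (r : Retract X Y) {c : ℤ} (h : t.IsLE Y c) : t.IsLE X c := by
  rw [t.isLE_iff_orthogonal c (c + 1) rfl] at h ⊢
  intro Z f hZ
  exact HomZero.of_retract (fun f => h Z f hZ) r f

variable {t} in
lemma isLE_mono {X : T} {p q : ℤ} (h : t.IsLE X p) (hpq : p ≤ q) : t.IsLE X q :=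
  t.isLE_of_le X p q hpq

variable {t} in
lemma isLE_shift_of_le {X : T} {p : ℤ} (h : t.IsLE X p) (a : ℤ) {q : ℤ} (hpq : p ≤ a + q) :
    t.IsLE (X⟦a⟧) q :=
  isLE_mono (t.isLE_shift X p a (p - a) (by lia)) (by lia)

instance : t.minus.IsStableUnderRetracts where
  of_retract r := by
    rintro ⟨c, hc⟩
    exact ⟨c, isLE_of_retract t r hc⟩

/-- The objects `Y` with `Hom(Y, T^{≤ c}) = 0`. -/
def coGT (c : ℤ) : ObjectProperty T := fun Y => ∀ Z : T, t.IsLE Z c → HomZero Y Z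

variable {t}

lemma coGT.mono {Y : T} {c c' : ℤ} (h : coGT t c Y) (hc : c' ≤ c) : coGT t c' Y :=
  fun Z _ => h Z (t.isLE_of_le Z c' c hc)

lemma coGT.shift {Y : T} {c : ℤ} (h : coGT t c Y) {a c' : ℤ} (ha : c' + a = c) :
    coGT t c' (Y⟦a⟧) := fun Z _ =>
  (homZero_shift_left_iff Y Z (show a + (-a) = 0 by lia)).2
    (h _ (t.isLE_shift Z c' (-a) c (by lia)))

lemma coGT.of_retract {X Y : T} {c : ℤ} (h : coGT t c Y) (r : Retract X Y) : coGT t c X :=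
  fun Z hZ => (h Z hZ).of_retract r

variable (t) in
/-- The objects which are left orthogonal to some `T^{≤ c}`. -/
def coMinus : ObjectProperty T := fun Y => ∃ c, coGT t c Y

instance : (coMinus t).IsStableUnderRetracts where
  of_retract r := by
    rintro ⟨c, hc⟩
    exact ⟨c, hc.of_retract r⟩

instance : (coMinus t).IsTriangulated where
  exists_zero := ⟨_, isZero_zero T, 0, fun _ _ f => (isZero_zero T).eq_of_src _ _⟩
  isStableUnderShiftBy a :=
    { le_shift := by
        rintro Y ⟨c, hc⟩
        exact ⟨c - a, hc.shift (by lia)⟩ }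
  toIsTriangulatedClosed₂ := .mk' (by
    rintro ⟨_, _, _, _, _, _⟩ hT ⟨c₁, h₁⟩ ⟨c₃, h₃⟩
    exact ⟨min c₁ c₃, fun Z hZ => HomZero.ext_left hT
      (h₁.mono (min_le_left _ _) Z hZ) (h₃.mono (min_le_right _ _) Z hZ)⟩)

end TStructure

/-! ### Consequences of the axioms for the adjacent t-structure. -/

section Silting

open Triangulated

variable (k : Type*) [Field k] {T : Type*} [Category* T] [HasZeroObject T] [HasShift T ℤ]
  [Preadditive T] [Linear k T] [∀ i : ℤ, (shiftFunctor T i).Additive] [Pretriangulated T]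

/-- The properties of an `n`-Calabi-Yau triple `(T, Tfd, add M)` in terms of the adjacent
t-structure. -/
structure SiltingTStructure (n : ℤ) (Tfd : ObjectProperty T) (M : T) (t : TStructure T) :
    Prop where
  homFinite : HomFinite k T
  isLE_iff : ∀ (X : T) (c : ℤ), t.IsLE X c ↔ ∀ i, c < i → HomZero M (X⟦i⟧)
  isLE_self : t.IsLE M 0
  coGT_self : coGT t (-1) M
  exists_coGT : ∀ X, ∃ c, coGT t c X
  isGE_le : ∀ X, t.IsGE X 0 → Tfd X
  exists_isGE : ∀ X, Tfd X → ∃ c, t.IsGE X c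
  homZero_iff : ∀ (X Y : T) (c : ℤ), t.IsGE X c → (HomZero X Y ↔ HomZero Y (X⟦n⟧))

variable {k}

omit [HasZeroObject T] [∀ i : ℤ, (shiftFunctor T i).Additive] [Pretriangulated T] in
lemma TraceForm.homZero_iff {𝓢 : ObjectProperty T} {n : ℤ} (τ : TraceForm k 𝓢 n) {X : T}
    (hX : 𝓢 X) (Y : T) : HomZero X Y ↔ HomZero Y (X⟦n⟧) :=
  ⟨fun H g => τ.eq_zero_of_right hX g (fun f => by simp [H f]),
    fun H f => τ.eq_zero_of_left hX f (fun g => by simp [H g])⟩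

lemma rightOrthogonal_shifts_iff (M X : T) (I : Set ℤ) :
    (shifts (add M) I).rightOrthogonal X ↔ ∀ i, -i ∈ I → HomZero M (X⟦i⟧) := by
  constructor
  · intro h i hi
    exact (homZero_shift_left_iff M X (neg_add_cancel i)).1
      (fun f => h f ⟨-i, hi, M, add_self M, ⟨Iso.refl _⟩⟩)
  · rintro h Y f ⟨i, hi, A, hA, ⟨e⟩⟩
    exact (((homZero_shift_left_iff A X (add_neg_cancel i)).2
      (HomZero.of_add (h (-i) (by simpa using hi)) hA)).of_iso e.symm (Iso.refl _)) f

lemma IsCalabiYauTriple.exists_siltingTStructure {n : ℤ} {Tfd : ObjectProperty T}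
    [Tfd.IsTriangulated] {M : T} (h : IsCalabiYauTriple k n Tfd (add M)) :
    ∃ t : TStructure T, SiltingTStructure k n Tfd M t := by
  obtain ⟨t, hle, hge, hfd⟩ := h.adjacent_tStructure
  obtain ⟨τ⟩ := h.relativeCalabiYau.nonempty_traceForm
  have isLE_iff : ∀ (X : T) (c : ℤ), t.IsLE X c ↔ ∀ i, c < i → HomZero M (X⟦i⟧) := by
    intro X c
    rw [← t.isLE_shift_iff X c c 0 (by lia), ← t.le_iff_isLE, hle, rightOrthogonal_shifts_iff]
    constructor
    · intro H i hi
      exact (H (i - c) (by simpa using hi)).of_iso (Iso.refl _)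
        ((shiftFunctorAdd' T c (i - c) i (by lia)).symm.app X)
    · intro H i hi
      exact (H (c + i) (by simp at hi; lia)).of_iso (Iso.refl _)
        ((shiftFunctorAdd' T c i (c + i) (by lia)).app X)
  have isGE_iff : ∀ (X : T) (c : ℤ), t.IsGE X c ↔ ∀ i, i < c → HomZero M (X⟦i⟧) := by
    intro X c
    rw [← t.isGE_shift_iff X c c 0 (by lia), ← t.ge_iff_isGE, hge, rightOrthogonal_shifts_iff]
    constructor
    · intro H i hi
      exact (H (i - c) (by simpa using hi)).of_iso (Iso.refl _)
        ((shiftFunctorAdd' T c (i - c) i (by lia)).symm.app X)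
    · intro H i hi
      exact (H (c + i) (by simp at hi; lia)).of_iso (Iso.refl _)
        ((shiftFunctorAdd' T c i (c + i) (by lia)).app X)
  have le_add : ∀ A, add M A → t.IsLE A 0 := fun A hA =>
    (isLE_iff A 0).2 (fun i hi => h.silting.1 i hi M A (add_self M) hA)
  have coGT_add : ∀ A, add M A → coGT t (-1) A := fun A hA Z hZ =>
    (HomZero.of_iso ((isLE_iff Z (-1)).1 hZ 0 (by lia)) (Iso.refl _)
      ((shiftFunctorZero T ℤ).app Z)).of_add hA
  -- `coMinus t` is thick and contains `M`, so silting generation makes it everything.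
  have exists_coGT : ∀ X, ∃ c, coGT t c X := by
    have : (add M).triangEnvelope ≤ coMinus t :=
      (ObjectProperty.triangEnvelope_le_iff _).2 (fun A hA => ⟨-1, coGT_add A hA⟩)
    rw [h.silting.2] at this
    exact fun X => this X trivial
  refine ⟨t, h.homFinite, isLE_iff, le_add M (add_self M), coGT_add M (add_self M),
    exists_coGT, fun X hX => hfd X (t.ge_of_isGE X 0), ?_, ?_⟩
  -- Duality turns `Hom(M, X⟦i⟧)` into `Hom(X, M⟦n - i⟧)`, which vanishes once `M⟦n - i⟧` lies in
  -- `T^{≤ c}`.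
  · intro X hX
    obtain ⟨c, hc⟩ := exists_coGT X
    refine ⟨n + c, (isGE_iff _ _).2 (fun i hi => ?_)⟩
    have : HomZero (M⟦n - i⟧) (X⟦n⟧) := (τ.homZero_iff hX _).1 (hc _ (by
      have := le_add M (add_self M)
      have := t.isLE_shift M 0 (n - i) (i - n) (by lia)
      exact t.isLE_of_le _ (i - n) c (by lia)))
    rw [homZero_shift_iff M X (a' := 0) (b' := i) (by lia)] at this
    exact this.of_iso ((shiftFunctorZero T ℤ).app M) (Iso.refl _)
  · intro X Y c hX
    -- Only `X⟦c⟧` is known to lie in `Tfd` itself, so duality is applied after shifting by `c`.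
    have := t.isGE_shift X c c 0 (by lia)
    have hX' : Tfd (X⟦c⟧) := hfd _ (t.ge_of_isGE _ 0)
    rw [← homZero_shift_shift_iff X Y c, τ.homZero_iff hX', ← homZero_shift_shift_iff Y (X⟦n⟧) c]
    exact ⟨fun H => H.of_iso (Iso.refl _) ((shiftFunctorComm T c n).app X),
      fun H => H.of_iso (Iso.refl _) ((shiftFunctorComm T n c).app X)⟩

end Silting

end CYTriple

namespace CYTriple

/-! ### Comparison of Hom-spaces in `T` and in the quotient. -/

section Quotient

open Triangulated

variable {k : Type*} [Field k] {T : Type*} [Category* T] [HasZeroObject T] [HasShift T ℤ]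
  [Preadditive T] [Linear k T] [∀ i : ℤ, (shiftFunctor T i).Additive]
  [Pretriangulated T] {n : ℤ} {Tfd : ObjectProperty T} {M : T} {t : TStructure T}

lemma isLE_obj₃ {X Y Z : T} {f : X ⟶ Y} {g : Y ⟶ Z} {h : Z ⟶ X⟦(1 : ℤ)⟧}
    (hT : Triangle.mk f g h ∈ distTriang T) {a b : ℤ} (hX : t.IsLE X a) (hY : t.IsLE Y b)
    (hab : a ≤ b + 1) : t.IsLE Z b := by
  refine t.isLE₂ _ (rot_of_distTriang _ hT) b hY ?_
  have := t.isLE_shift X a 1 (a - 1) (by lia)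
  exact t.isLE_of_le (X⟦(1 : ℤ)⟧) (a - 1) b (by lia)

variable [Tfd.IsTriangulated]

namespace SiltingTStructure

variable (hs : SiltingTStructure k n Tfd M t)

include hs

lemma isoClosure_of_isGE {X : T} {c : ℤ} (h : t.IsGE X c) : Tfd.isoClosure X := by
  have := t.isGE_shift X c c 0 (by lia)
  exact ⟨_, Tfd.le_shift (-c) _ (hs.isGE_le _ this),
    ⟨(shiftFunctorCompIsoId T c (-c) (by lia)).symm.app X⟩⟩

lemma exists_truncation (X : T) (b : ℤ) :
    ∃ (A Z : T) (s : A ⟶ X) (c : X ⟶ Z) (w : Z ⟶ A⟦(1 : ℤ)⟧),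
      Triangle.mk s c w ∈ distTriang T ∧ t.IsLE A b ∧ t.IsGE Z (b + 1) ∧ Tfd Z := by
  obtain ⟨A, Z, hA, hZ, s, c, w, hT⟩ := t.exists_triangle X b (b + 1) rfl
  -- `Tfd` need not be closed under isomorphisms, so the cone is replaced by an isomorphic object of
  -- `Tfd`.
  obtain ⟨Z', hZ', ⟨e⟩⟩ := hs.isoClosure_of_isGE ⟨hZ⟩
  refine ⟨A, Z', s, c ≫ e.hom, e.inv ≫ w, isomorphic_distinguished _ hT _
    (Triangle.isoMk _ _ (Iso.refl _) (Iso.refl _) e.symm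
      ((Category.comp_id s).trans (Category.id_comp s).symm) ?_ ?_), ⟨hA⟩,
    ⟨(t.ge (b + 1)).prop_of_iso e hZ⟩, hZ'⟩
  · change (c ≫ e.hom) ≫ e.inv = 𝟙 X ≫ c
    simp
  · change (e.inv ≫ w) ≫ (𝟙 A)⟦(1 : ℤ)⟧' = e.inv ≫ w
    simp

omit [Tfd.IsTriangulated] in
-- The cone of `s` is bounded below, so it receives no nonzero map from deep in the aisle.
-- Truncations are therefore cofinal among the denominators.
lemma exists_factorization {X' X : T} (s : X' ⟶ X) (h : Tfd.trW s) :
    ∃ b : ℤ, ∀ A : T, t.IsLE A b → ∀ a : A ⟶ X, ∃ a' : A ⟶ X', a' ≫ s = a := by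
  obtain ⟨Z, c, w, hT, hZ⟩ := h
  obtain ⟨b, hb⟩ := hs.exists_isGE Z hZ
  exact ⟨b - 1, fun A _ a => exists_lift_obj₁ hT a (t.zero _ (b - 1) b (by lia))⟩

omit [Tfd.IsTriangulated] in
-- By duality it suffices that `Hom(Y, Z⟦n⟧) = 0`, and `Z⟦n⟧` lies in `T^{≤ a - n}`. The lower bound
-- `c` only makes duality available.
lemma homZero_of_isLE {Z Y : T} {a c : ℤ} (hZ : t.IsLE Z a) (hZ' : t.IsGE Z c)
    (hY : coGT t (a - n) Y) : HomZero Z Y :=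
  (hs.homZero_iff Z Y c hZ').2 (hY _ (t.isLE_shift Z a n (a - n) (by lia)))

variable [IsTriangulated T]

lemma exists_preimage {X Y : T}
    (φ : (quotientFunctor Tfd).obj X ⟶ (quotientFunctor Tfd).obj Y) :
    ∃ b : ℤ, ∀ A : T, t.IsLE A b → ∀ a : A ⟶ X, ∃ g : A ⟶ Y,
      (quotientFunctor Tfd).map g = (quotientFunctor Tfd).map a ≫ φ := by
  obtain ⟨X', s, g, hs', hg⟩ := exists_roof φ
  obtain ⟨b, hb⟩ := hs.exists_factorization s hs'
  refine ⟨b, fun A hA a => ?_⟩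
  obtain ⟨a', rfl⟩ := hb A hA a
  exact ⟨a' ≫ g, by simp [hg]⟩

lemma exists_comp_eq_zero {X Y : T} (f : X ⟶ Y) (hf : (quotientFunctor Tfd).map f = 0) :
    ∃ b : ℤ, ∀ A : T, t.IsLE A b → ∀ a : A ⟶ X, a ≫ f = 0 := by
  have : (quotientFunctor Tfd).map f = (quotientFunctor Tfd).map (0 : X ⟶ Y) := by
    rw [hf, Functor.map_zero]
  rw [MorphismProperty.map_eq_iff_precomp (quotientFunctor Tfd) Tfd.trW] at this
  obtain ⟨X', s, hs', hsf⟩ := this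
  obtain ⟨b, hb⟩ := hs.exists_factorization s hs'
  refine ⟨b, fun A hA a => ?_⟩
  obtain ⟨a', rfl⟩ := hb A hA a
  rw [Category.assoc, hsf, comp_zero, comp_zero]

lemma map_injective {X Y : T} {a : ℤ} (hX : t.IsLE X a) (hY : coGT t (a - n) Y)
    (f : X ⟶ Y) (hf : (quotientFunctor Tfd).map f = 0) : f = 0 := by
  obtain ⟨b, hb⟩ := hs.exists_comp_eq_zero f hf
  -- Truncating below `b` makes `f` vanish on `A`; truncating below `a` keeps `Z` in `T^{≤ a}`.
  obtain ⟨A, Z, s, c, w, hT, hA, hZ, -⟩ := hs.exists_truncation X (min a b)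
  have hA' := t.isLE_of_le A (min a b) b (by lia)
  obtain ⟨g, rfl⟩ := exists_desc_obj₃ hT f (hb A hA' s)
  have hZ' : t.IsLE Z a := isLE_obj₃ hT hA hX (by lia)
  rw [hs.homZero_of_isLE hZ' hZ hY g, comp_zero]

/-- A morphism on a deep truncation `A` extends to `X` when the obstruction in `Hom(Z, Y⟦1⟧)`
vanishes. The shift of `Y` costs the extra `+ 1` in the bound. -/
lemma map_surjective {X Y : T} {a : ℤ} (hX : t.IsLE X a) (hY : coGT t (a - n + 1) Y)
    (φ : (quotientFunctor Tfd).obj X ⟶ (quotientFunctor Tfd).obj Y) :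
    ∃ f : X ⟶ Y, (quotientFunctor Tfd).map f = φ := by
  obtain ⟨b, hb⟩ := hs.exists_preimage φ
  obtain ⟨A, Z, s, c, w, hT, hA, hZ, hZ'⟩ := hs.exists_truncation X (min a b)
  have hA' := t.isLE_of_le A (min a b) b (by lia)
  obtain ⟨g, hg⟩ := hb A hA' s
  have hZ'' : t.IsLE Z a := isLE_obj₃ hT hA hX (by lia)
  obtain ⟨f, rfl⟩ := exists_desc_obj₂ hT g
    (hs.homZero_of_isLE hZ'' hZ (hY.shift (by lia)) _)
  have := isIso_map_quotientFunctor (𝓢 := Tfd) s ⟨_, _, _, hT, hZ'⟩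
  exact ⟨f, by rwa [Functor.map_comp, cancel_epi] at hg⟩

omit [IsTriangulated T] in
/-- Every object is isomorphic in the quotient to an object of `T^{≤ a}`. -/
lemma exists_isLE_trW (X : T) (a : ℤ) : ∃ (A : T) (s : A ⟶ X), t.IsLE A a ∧ Tfd.trW s := by
  obtain ⟨A, Z, s, c, w, hT, hA, -, hZ⟩ := hs.exists_truncation X a
  exact ⟨A, s, hA, _, _, _, hT, hZ⟩

lemma homFinite_quotient [∀ i : ℤ, (shiftFunctor T i).Linear k] :
    HomFinite k (VerdierQuotient Tfd) := by
  suffices ∀ X Y : T, Module.Finite k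
      ((quotientFunctor Tfd).obj X ⟶ (quotientFunctor Tfd).obj Y) from
    fun X Y => this X.as.obj Y.as.obj
  intro X Y
  obtain ⟨c, hc⟩ := hs.exists_coGT Y
  -- The level `c + n - 1` is the largest for which `coGT t c Y` suffices in `map_surjective`.
  obtain ⟨A, s, hA, hs'⟩ := hs.exists_isLE_trW X (c + n - 1)
  have := isIso_map_quotientFunctor s hs'
  have := hs.homFinite A Y
  let φ : (A ⟶ Y) →ₗ[k] ((quotientFunctor Tfd).obj X ⟶ (quotientFunctor Tfd).obj Y) :=
    Linear.leftComp k _ (inv ((quotientFunctor Tfd).map s)) ∘ₗ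
      (quotientFunctor Tfd).mapLinearMap k
  refine Module.Finite.of_surjective φ (fun ψ => ?_)
  obtain ⟨f, hf⟩ := hs.map_surjective hA (hc.mono (show c + n - 1 - n + 1 ≤ c by lia))
    ((quotientFunctor Tfd).map s ≫ ψ)
  exact ⟨f, by simp [φ, hf]⟩

end SiltingTStructure

/-! ### Nondegeneracy of the quotient trace. -/

section Nondegenerate

variable [∀ i : ℤ, (shiftFunctor T i).Linear k] [IsTriangulated T] (τ : TraceForm k Tfd n)
  {d : ℤ} (hd : d + 1 = n)

lemma quotientTrace_map_comp {X Y Y' Z : T} {s : Y' ⟶ Y} {c : Y ⟶ Z} {w : Z ⟶ Y'⟦(1 : ℤ)⟧}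
    (hT : Triangle.mk s c w ∈ distTriang T) (hZ : Tfd Z) (f : X ⟶ Y) (g' : Y' ⟶ X⟦d⟧)
    (g : (quotientFunctor Tfd).obj Y ⟶ ((quotientFunctor Tfd).obj X)⟦d⟧)
    (hg : (quotientFunctor Tfd).map g' ≫ ((quotientFunctor Tfd).commShiftIso d).hom.app X =
      (quotientFunctor Tfd).map s ≫ g) :
    quotientTrace τ hd X ((quotientFunctor Tfd).map f ≫ g) =
      τ.tr Z ((w ≫ g'⟦(1 : ℤ)⟧' ≫ (shiftFunctorAdd' T d 1 n hd).inv.app X) ≫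
        (f ≫ c)⟦n⟧') := by
  rw [quotientTrace_comm_map, quotientTrace_eq τ hd _ (g' ≫ f⟦d⟧') hT hZ, roofTrace_apply]
  · have nat := (shiftFunctorAdd' T d 1 n hd).inv.naturality_assoc f (c⟦n⟧')
    simp only [Category.assoc, Functor.map_comp]
    exact congrArg (fun q => τ.tr Z (w ≫ g'⟦(1 : ℤ)⟧' ≫ q)) nat
  · rw [Functor.map_comp, Category.assoc, Functor.commShiftIso_hom_naturality, reassoc_of% hg]

namespace SiltingTStructure

variable (hs : SiltingTStructure k n Tfd M t)

include hs

lemma quotientTrace_left_of_isLE {X Y : T} {a : ℤ} (hX : t.IsLE X a)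
    (hY : coGT t (a - n + 1) Y) (f : (quotientFunctor Tfd).obj X ⟶ (quotientFunctor Tfd).obj Y)
    (hf : ∀ g : (quotientFunctor Tfd).obj Y ⟶ ((quotientFunctor Tfd).obj X)⟦d⟧,
      quotientTrace τ hd X (f ≫ g) = 0) : f = 0 := by
  obtain ⟨f, rfl⟩ := hs.map_surjective hX hY f
  obtain ⟨b, hb⟩ := hs.exists_coGT X
  obtain ⟨A, Z, s, c, w, hT, hA, -, hZ⟩ := hs.exists_truncation Y b
  suffices f ≫ c = 0 by
    obtain ⟨f', rfl⟩ := exists_lift_obj₁ hT f this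
    rw [hb A hA f', zero_comp, Functor.map_zero]
  refine (shiftFunctor T n).map_injective ?_
  rw [Functor.map_zero]
  refine τ.eq_zero_of_right hZ _ (fun p => ?_)
  -- Every `p : Z ⟶ X⟦n⟧` vanishes on `Y`, hence comes from `A⟦1⟧` and so from a roof `Y ⟵ A ⟶
  -- X⟦d⟧`. Testing against `τ` on `Z` is thus testing against the quotient trace.
  obtain ⟨q, rfl⟩ := exists_desc_shift_obj₁ hT p
    (hY _ (isLE_shift_of_le hX n (by lia)) _)
  obtain ⟨g', hg'⟩ := (shiftFunctor T (1 : ℤ)).map_surjective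
    (q ≫ (shiftFunctorAdd' T d 1 n hd).hom.app X)
  have hs' := isIso_map_quotientFunctor (𝓢 := Tfd) s ⟨_, _, _, hT, hZ⟩
  have := quotientTrace_map_comp τ hd hT hZ f g' (inv ((quotientFunctor Tfd).map s) ≫
    (quotientFunctor Tfd).map g' ≫ ((quotientFunctor Tfd).commShiftIso d).hom.app X) (by simp)
  rw [hf, hg', Category.assoc q, Iso.hom_inv_id_app, Category.comp_id] at this
  exact this.symm

lemma quotientTrace_right_of_isLE {X Y : T} {a : ℤ} (hX : t.IsLE X a)
    (hY : coGT t (a - n + 1) Y)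
    (g : (quotientFunctor Tfd).obj Y ⟶ ((quotientFunctor Tfd).obj X)⟦d⟧)
    (hg : ∀ f : (quotientFunctor Tfd).obj X ⟶ (quotientFunctor Tfd).obj Y,
      quotientTrace τ hd X (f ≫ g) = 0) : g = 0 := by
  obtain ⟨b, hb⟩ := hs.exists_preimage (g ≫ ((quotientFunctor Tfd).commShiftIso d).inv.app X)
  obtain ⟨c₀, hc₀⟩ := hs.exists_coGT X
  obtain ⟨A, Z, s, c, w, hT, hA, -, hZ⟩ := hs.exists_truncation Y (min b c₀)
  obtain ⟨g', hg'⟩ := hb A (t.isLE_of_le A (min b c₀) b (by lia)) s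
  have hs' := isIso_map_quotientFunctor (𝓢 := Tfd) s ⟨_, _, _, hT, hZ⟩
  suffices g' = 0 by
    rw [this, Functor.map_zero, ← Category.assoc] at hg'
    rw [← cancel_epi ((quotientFunctor Tfd).map s),
      ← cancel_mono (((quotientFunctor Tfd).commShiftIso d).inv.app X), ← hg', comp_zero,
      zero_comp]
  suffices w ≫ g'⟦(1 : ℤ)⟧' ≫ (shiftFunctorAdd' T d 1 n hd).inv.app X = 0 by
    rw [← Category.assoc] at this
    obtain ⟨p, rfl⟩ := exists_desc_obj₂ hT g' (by
      rwa [← cancel_mono ((shiftFunctorAdd' T d 1 n hd).inv.app X), zero_comp])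
    rw [hY _ (t.isLE_shift X a d (a - n + 1) (by lia)) p, comp_zero]
  refine τ.eq_zero_of_left hZ _ (fun q => ?_)
  obtain ⟨q, rfl⟩ := (shiftFunctor T n).map_surjective q
  -- The bound `c₀` gives `Hom(X, A⟦1⟧) = 0`, so each test map `X ⟶ Z` lifts to `X ⟶ Y`.
  obtain ⟨f, rfl⟩ := exists_lift_obj₂ hT q (hc₀ _ (isLE_shift_of_le hA 1 (by lia)) _)
  rw [← quotientTrace_map_comp τ hd hT hZ f g' g (by simp [hg']), hg]

lemma quotientTrace_left {X Y : T}
    (f : (quotientFunctor Tfd).obj X ⟶ (quotientFunctor Tfd).obj Y)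
    (hf : ∀ g : (quotientFunctor Tfd).obj Y ⟶ ((quotientFunctor Tfd).obj X)⟦d⟧,
      quotientTrace τ hd X (f ≫ g) = 0) : f = 0 := by
  obtain ⟨c, hc⟩ := hs.exists_coGT Y
  obtain ⟨A, s, hA, hs'⟩ := hs.exists_isLE_trW X (c + n - 1)
  have := isIso_map_quotientFunctor s hs'
  rw [← cancel_epi ((quotientFunctor Tfd).map s), comp_zero]
  refine hs.quotientTrace_left_of_isLE τ hd hA (hc.mono (show c + n - 1 - n + 1 ≤ c by lia)) _
    (fun g => ?_)
  rw [Category.assoc, quotientTrace_comm, Category.assoc, hf]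

lemma quotientTrace_right {X Y : T}
    (g : (quotientFunctor Tfd).obj Y ⟶ ((quotientFunctor Tfd).obj X)⟦d⟧)
    (hg : ∀ f : (quotientFunctor Tfd).obj X ⟶ (quotientFunctor Tfd).obj Y,
      quotientTrace τ hd X (f ≫ g) = 0) : g = 0 := by
  obtain ⟨c, hc⟩ := hs.exists_coGT Y
  obtain ⟨A, s, hA, hs'⟩ := hs.exists_isLE_trW X (c + n - 1)
  have := isIso_map_quotientFunctor s hs'
  rw [← cancel_mono ((inv ((quotientFunctor Tfd).map s))⟦d⟧'), zero_comp]
  refine hs.quotientTrace_right_of_isLE τ hd hA (hc.mono (show c + n - 1 - n + 1 ≤ c by lia)) _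
    (fun f => ?_)
  rw [← Category.assoc, ← quotientTrace_comm, ← Category.assoc, hg]

include τ hd in
lemma nonempty_traceForm_quotient :
    Nonempty (TraceForm k (⊤ : ObjectProperty (VerdierQuotient Tfd)) d) :=
  ⟨{ tr := fun X => quotientTrace τ hd X.as.obj
     tr_comm := fun {X Y} _ _ f g => quotientTrace_comm τ hd (X := X.as.obj) (Y := Y.as.obj) f g
     eq_zero_of_left := fun {X Y} _ f h =>
      hs.quotientTrace_left τ hd (X := X.as.obj) (Y := Y.as.obj) f h
     eq_zero_of_right := fun {X Y} _ g h =>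
      hs.quotientTrace_right τ hd (X := X.as.obj) (Y := Y.as.obj) g h }⟩

end SiltingTStructure

end Nondegenerate

end Quotient

end CYTriple

namespace CYTriple

/-! ### Approximations by sums of `M`. -/

section Approximation

variable {k : Type*} [Field k] {C : Type*} [Category* C] [Preadditive C] [Linear k C]
  [HasFiniteBiproducts C]

lemma HomFinite.exists_add_cover (h : HomFinite k C) (M X : C) :
    ∃ (m : ℕ) (p : (⨁ fun _ : Fin m => M) ⟶ X), ∀ f : M ⟶ X, ∃ g, g ≫ p = f := by
  have := h M X
  obtain ⟨m, s, hs⟩ := Module.Finite.exists_fin (R := k) (M := M ⟶ X)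
  refine ⟨m, biproduct.desc s, fun f => ?_⟩
  have hf : f ∈ Submodule.span k (Set.range s) := by rw [hs]; trivial
  obtain ⟨c, rfl⟩ := (Submodule.mem_span_range_iff_exists_fun k).1 hf
  exact ⟨biproduct.lift (fun i => c i • 𝟙 M), by simp [biproduct.lift_desc]⟩

lemma HomFinite.exists_add_hull (h : HomFinite k C) (M X : C) :
    ∃ (m : ℕ) (p : X ⟶ (⨁ fun _ : Fin m => M)), ∀ f : X ⟶ M, ∃ g, p ≫ g = f := by
  have := h X M
  obtain ⟨m, s, hs⟩ := Module.Finite.exists_fin (R := k) (M := X ⟶ M)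
  refine ⟨m, biproduct.lift s, fun f => ?_⟩
  have hf : f ∈ Submodule.span k (Set.range s) := by rw [hs]; trivial
  obtain ⟨c, rfl⟩ := (Submodule.mem_span_range_iff_exists_fun k).1 hf
  exact ⟨biproduct.desc (fun i => c i • 𝟙 M), by simp [biproduct.lift_desc]⟩

lemma add_biproduct (M : C) (m : ℕ) : add M (⨁ fun _ : Fin m => M) := ⟨m, ⟨Retract.refl _⟩⟩

lemma HomFinite.functoriallyFinite_add (h : HomFinite k C) (M : C) :
    FunctoriallyFinite (add M) := by
  constructor
  · intro X
    obtain ⟨m, p, hp⟩ := h.exists_add_cover M X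
    refine ⟨_, p, add_biproduct M m, ?_⟩
    rintro A ⟨m', ⟨r⟩⟩ f
    choose g hg using fun i => hp (biproduct.ι (fun _ : Fin m' => M) i ≫ r.r ≫ f)
    refine ⟨r.i ≫ biproduct.desc g, ?_⟩
    have : biproduct.desc g ≫ p = r.r ≫ f := by
      ext i
      simp [hg]
    rw [Category.assoc, this, r.retract_assoc]
  · intro X
    obtain ⟨m, p, hp⟩ := h.exists_add_hull M X
    refine ⟨_, p, add_biproduct M m, ?_⟩
    rintro A ⟨m', ⟨r⟩⟩ f
    choose g hg using fun i => hp (f ≫ r.i ≫ biproduct.π (fun _ : Fin m' => M) i)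
    refine ⟨biproduct.lift g ≫ r.r, ?_⟩
    have : p ≫ biproduct.lift g = f ≫ r.i := by
      ext i
      simp [hg]
    rw [reassoc_of% this, r.retract, Category.comp_id]

lemma add_of_iso {M A B : C} (e : A ≅ B) (h : add M A) : add M B := by
  obtain ⟨m, ⟨r⟩⟩ := h
  exact ⟨m, ⟨(Retract.ofIso e.symm).trans r⟩⟩

lemma add_map {D : Type*} [Category* D] [Preadditive D] [HasFiniteBiproducts D] (F : C ⥤ D)
    [F.Additive] {M A : C} (h : add M A) : add (F.obj M) (F.obj A) := by
  obtain ⟨m, ⟨r⟩⟩ := h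
  exact ⟨m, ⟨(r.map F).trans (Retract.ofIso (F.mapBiproduct _))⟩⟩

end Approximation

/-! ### Coreflection into the heart. -/

section Coreflection

open Triangulated

variable {k : Type*} [Field k] {T : Type*} [Category* T] [HasZeroObject T] [HasShift T ℤ]
  [Preadditive T] [Linear k T] [∀ i : ℤ, (shiftFunctor T i).Additive]
  [Pretriangulated T] {n : ℤ} {Tfd : ObjectProperty T} {M : T} {t : TStructure T}

section

variable {X Y Z : T} {f : X ⟶ Y} {g : Y ⟶ Z} {h : Z ⟶ X⟦(1 : ℤ)⟧}

lemma plus_obj₁ (hT : Triangle.mk f g h ∈ distTriang T) (hY : t.plus Y) (hZ : t.plus Z) :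
    t.plus X :=
  t.plus.ext_of_isTriangulatedClosed₁ _ hT hY hZ

lemma plus_obj₃ (hT : Triangle.mk f g h ∈ distTriang T) (hX : t.plus X) (hY : t.plus Y) :
    t.plus Z :=
  t.plus.ext_of_isTriangulatedClosed₃ _ hT hX hY

end

variable (t) in
/-- The heart of the t-structure. -/
def heartObj (X : T) : Prop := t.IsLE X 0 ∧ t.IsGE X 0

lemma heartObj.plus {X : T} (h : heartObj t X) : t.plus X := ⟨0, h.2⟩

lemma heartObj.ext {X Y Z : T} {f : X ⟶ Y} {g : Y ⟶ Z} {h : Z ⟶ X⟦(1 : ℤ)⟧}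
    (hT : Triangle.mk f g h ∈ distTriang T) (hX : heartObj t X) (hZ : heartObj t Z) :
    heartObj t Y :=
  ⟨t.isLE₂ _ hT 0 hX.1 hZ.1, t.isGE₂ _ hT 0 hX.2 hZ.2⟩

lemma heartObj.biprod {X Y : T} (hX : heartObj t X) (hY : heartObj t Y) : heartObj t (X ⊞ Y) :=
  heartObj.ext (binaryBiproductTriangle_distinguished X Y) hX hY

variable (t) in
/-- No bounded below object of `T^{≤ 0}` has a nonzero morphism to `V` that `x` kills. -/
def IsReduced {V X : T} (x : V ⟶ X) : Prop :=
  ∀ K : T, t.IsLE K 0 → t.plus K → ∀ a : K ⟶ V, a ≫ x = 0 → a = 0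

lemma IsReduced.shift {V X : T} {x : V ⟶ X} (hx : IsReduced t x) {B : T} (hB : t.IsLE B (-1))
    (hB' : t.plus B) (b : B ⟶ V⟦(1 : ℤ)⟧) (hb : b ≫ x⟦(1 : ℤ)⟧' = 0) : b = 0 := by
  obtain ⟨b', hb'⟩ := (shiftFunctor T (1 : ℤ)).map_surjective
    ((shiftFunctorCompIsoId T (-1 : ℤ) 1 (by lia)).hom.app B ≫ b)
  have : b' = 0 := by
    refine hx _ (isLE_shift_of_le hB (-1) (by lia)) (t.plus.le_shift (-1) _ hB') b' ?_
    refine (shiftFunctor T (1 : ℤ)).map_injective ?_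
    rw [Functor.map_comp, hb', Category.assoc, hb, comp_zero, Functor.map_zero]
  rw [this, Functor.map_zero] at hb'
  rw [← cancel_epi ((shiftFunctorCompIsoId T (-1 : ℤ) 1 (by lia)).hom.app B), ← hb', comp_zero]

namespace SiltingTStructure

variable (hs : SiltingTStructure k n Tfd M t)

include hs

/-- Surjectivity of `p` on maps from `M` kills `Hom(M, Z)`, which lowers the cone to `T^{≤ -1}`. -/
lemma exists_add_triangle {X : T} (hX : t.IsLE X 0) :
    ∃ (m : ℕ) (Z : T) (p : (⨁ fun _ : Fin m => M) ⟶ X) (c : X ⟶ Z)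
      (w : Z ⟶ (⨁ fun _ : Fin m => M)⟦(1 : ℤ)⟧),
      Triangle.mk p c w ∈ distTriang T ∧ t.IsLE Z (-1) := by
  obtain ⟨m, p, hp⟩ := hs.homFinite.exists_add_cover M X
  obtain ⟨Z, c, w, hT⟩ := distinguished_cocone_triangle p
  have hpc : p ≫ c = 0 := comp_distTriang_mor_zero₁₂ _ hT
  have hN : t.IsLE (⨁ fun _ : Fin m => M) 0 := by
    rw [t.isLE_iff_orthogonal 0 1 (by lia)]
    intro Y f hY
    have := hs.isLE_self
    exact HomZero.of_add (fun f => t.zero f 0 1 (by lia)) (add_biproduct M m) f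
  have hZ : t.IsLE Z 0 := isLE_obj₃ hT hN hX (by lia)
  refine ⟨m, Z, p, c, w, hT, (hs.isLE_iff Z (-1)).2 (fun i hi => ?_)⟩
  obtain rfl | hi : i = 0 ∨ 0 < i := by lia
  · refine HomZero.of_iso (X := M) (Y := Z) (fun φ => ?_) (Iso.refl _)
      ((shiftFunctorZero T ℤ).symm.app Z)
    obtain ⟨ψ, rfl⟩ := exists_lift_obj₂ hT φ
      (hs.coGT_self _ (isLE_shift_of_le hN 1 (by lia)) _)
    obtain ⟨g, rfl⟩ := hp ψ
    rw [Category.assoc, hpc, comp_zero]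
  · exact (hs.isLE_iff Z 0).1 hZ i hi

lemma eq_zero_of_comp_eq_zero {V Y : T} (hV : t.IsLE V 0) (hY : t.IsGE Y 0) (f : V ⟶ Y)
    (hf : ∀ a : M ⟶ V, a ≫ f = 0) : f = 0 := by
  obtain ⟨m, Z, p, c, w, hT, hZ⟩ := hs.exists_add_triangle hV
  obtain ⟨g, rfl⟩ := exists_desc_obj₃ hT f (by
    ext i
    simpa using hf (biproduct.ι (fun _ : Fin m => M) i ≫ p))
  rw [t.zero g (-1) 0 (by lia), comp_zero]

/-- The projective generator `H^0(M)` of the heart, with the projection from `M`. -/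
lemma exists_heart_generator : ∃ (P : T) (π : M ⟶ P), heartObj t P ∧
    (∀ V : T, heartObj t V → ∀ a : M ⟶ V, ∃ b : P ⟶ V, π ≫ b = a) ∧
    ∀ V : T, heartObj t V → ∀ b : P ⟶ V, π ≫ b = 0 → b = 0 := by
  obtain ⟨A, P, hA, hP, s, π, w, hT⟩ := t.exists_triangle M (-1) 0 (by lia)
  have hA : t.IsLE A (-1) := ⟨hA⟩
  refine ⟨P, π, ⟨isLE_obj₃ hT hA hs.isLE_self (by lia), ⟨hP⟩⟩, fun V hV a => ?_,
    fun V hV b hb => ?_⟩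
  · have := hV.2
    exact exists_desc_obj₃ hT a (t.zero _ (-1) 0 (by lia))
  · obtain ⟨q, rfl⟩ := exists_desc_shift_obj₁ hT b hb
    have := hV.2
    have : t.IsLE (A⟦(1 : ℤ)⟧) (-1) := isLE_shift_of_le hA 1 (by lia)
    rw [t.zero q (-1) 0 (by lia), comp_zero]

/-- If `a : K ⟶ V` witnesses non-reducedness, `x` factors through the cone of `a`, and even through
its `H^0`, since bounded objects of `T^{≤ -1}` have no maps to `X`. As `M` detects `a`, the
dimension drops. -/
lemma exists_reduced_quotient_step {X V : T} (hX : coGT t (-1 - n) X) (hV : heartObj t V)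
    (x : V ⟶ X) (hx : ¬ IsReduced t x) :
    ∃ (V' : T) (π : V ⟶ V') (x' : V' ⟶ X), heartObj t V' ∧ π ≫ x' = x ∧
      Module.finrank k (M ⟶ V') < Module.finrank k (M ⟶ V) := by
  simp only [IsReduced, not_forall] at hx
  obtain ⟨K, hK, hK', a, hax, ha⟩ := hx
  obtain ⟨C, c, w, hT⟩ := distinguished_cocone_triangle a
  have hac : a ≫ c = 0 := comp_distTriang_mor_zero₁₂ _ hT
  have hC : t.IsLE C 0 := isLE_obj₃ hT hK hV.1 (by lia)
  have hC' : t.plus C := plus_obj₃ hT hK' hV.plus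
  obtain ⟨y, rfl⟩ := exists_desc_obj₃ hT x hax
  obtain ⟨A, V', hA, hV', s, q, w', hT'⟩ := t.exists_triangle C (-1) 0 (by lia)
  have hA : t.IsLE A (-1) := ⟨hA⟩
  have hV' : heartObj t V' := ⟨isLE_obj₃ hT' hA hC (by lia), ⟨hV'⟩⟩
  obtain ⟨r, hr⟩ : t.plus A := plus_obj₁ hT' hC' hV'.plus
  obtain ⟨x', rfl⟩ := exists_desc_obj₃ hT' y (hs.homZero_of_isLE hA hr hX _)
  refine ⟨V', c ≫ q, x', hV', by simp, ?_⟩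
  have := hs.homFinite M V
  have := hs.homFinite M V'
  let φ : (M ⟶ V) →ₗ[k] (M ⟶ V') := Linear.rightComp k M (c ≫ q)
  have hφ : ∀ f, φ f = f ≫ c ≫ q := fun _ => rfl
  have surj : Function.Surjective φ := by
    intro f
    obtain ⟨f, rfl⟩ := exists_lift_obj₂ hT' f
      (hs.coGT_self _ (isLE_shift_of_le hA 1 (by lia)) _)
    obtain ⟨f, rfl⟩ := exists_lift_obj₂ hT f
      (hs.coGT_self _ (isLE_shift_of_le hK 1 (by lia)) _)
    exact ⟨f, by simp [hφ]⟩
  obtain ⟨b, hb⟩ : ∃ b : M ⟶ K, b ≫ a ≠ 0 := by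
    by_contra! H
    exact ha (hs.eq_zero_of_comp_eq_zero hK hV.2 a H)
  have ker : 0 < Module.finrank k (LinearMap.ker φ) := by
    rw [Module.finrank_pos_iff_exists_ne_zero]
    refine ⟨⟨b ≫ a, ?_⟩, fun H => hb (congrArg Subtype.val H)⟩
    rw [LinearMap.mem_ker, hφ, Category.assoc, reassoc_of% hac, zero_comp, comp_zero]
  have := φ.finrank_range_add_finrank_ker
  rw [LinearMap.range_eq_top.2 surj, finrank_top] at this
  lia

lemma exists_reduced_quotient {X : T} (hX : coGT t (-1 - n) X) (r : ℕ) :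
    ∀ (V : T), heartObj t V → Module.finrank k (M ⟶ V) = r → ∀ (x : V ⟶ X),
    ∃ (V' : T) (π : V ⟶ V') (x' : V' ⟶ X), heartObj t V' ∧ π ≫ x' = x ∧ IsReduced t x' := by
  induction r using Nat.strong_induction_on with
  | _ r ih =>
    intro V hV hr x
    by_cases hx : IsReduced t x
    · exact ⟨V, 𝟙 V, x, hV, by simp, hx⟩
    · obtain ⟨V₁, π₁, x₁, hV₁, rfl, hlt⟩ := hs.exists_reduced_quotient_step hX hV x hx
      obtain ⟨V₂, π₂, x₂, hV₂, rfl, hx₂⟩ := ih _ (hr ▸ hlt) V₁ hV₁ rfl x₁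
      exact ⟨V₂, π₁ ≫ π₂, x₂, hV₂, by simp, hx₂⟩

lemma exists_finrank_le (X : T) : ∃ N : ℕ, ∀ (V : T) (x : V ⟶ X), heartObj t V → IsReduced t x →
    Module.finrank k (M ⟶ V) ≤ N := by
  obtain ⟨P, π, hP, hP', -⟩ := hs.exists_heart_generator
  refine ⟨Module.finrank k (P ⟶ X), fun V x hV hx => ?_⟩
  have := hs.homFinite P V
  have := hs.homFinite P X
  calc Module.finrank k (M ⟶ V) ≤ Module.finrank k (P ⟶ V) :=
        LinearMap.finrank_le_finrank_of_surjective (f := Linear.leftComp k V π)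
          (fun a => hP' V hV a)
    _ ≤ Module.finrank k (P ⟶ X) := by
        refine LinearMap.finrank_le_finrank_of_injective (f := Linear.rightComp k P x) ?_
        rw [injective_iff_map_eq_zero]
        exact fun a ha => hx P hP.1 hP.plus a ha

lemma isIso_of_reduced {V V' X : T} (hV : heartObj t V) (hV' : heartObj t V') {x : V ⟶ X}
    (hx : IsReduced t x) (β : V ⟶ V') (x' : V' ⟶ X) (hβ : β ≫ x' = x)
    (hle : Module.finrank k (M ⟶ V') ≤ Module.finrank k (M ⟶ V)) : IsIso β := by
  obtain ⟨P, π, hP, hP₁, hP₂⟩ := hs.exists_heart_generator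
  have := hs.homFinite M V
  have := hs.homFinite M V'
  let φ : (M ⟶ V) →ₗ[k] (M ⟶ V') := Linear.rightComp k M β
  have hφ : ∀ f, φ f = f ≫ β := fun _ => rfl
  have inj : Function.Injective φ := by
    rw [injective_iff_map_eq_zero]
    intro f hf
    obtain ⟨p, rfl⟩ := hP₁ V hV f
    have hp : p ≫ β = 0 := hP₂ V' hV' _ (by rw [← Category.assoc]; exact hf)
    rw [hx P hP.1 hP.plus p (by rw [← hβ, reassoc_of% hp, zero_comp]), comp_zero]
  have surj : Function.Surjective φ :=
    (LinearMap.injective_iff_surjective_of_finrank_eq_finrank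
      (le_antisymm (LinearMap.finrank_le_finrank_of_injective inj) hle)).1 inj
  obtain ⟨D, c, w, hT⟩ := distinguished_cocone_triangle β
  have hβc : β ≫ c = 0 := comp_distTriang_mor_zero₁₂ _ hT
  have hD₀ : t.IsLE D 0 := isLE_obj₃ hT hV.1 hV'.1 (by lia)
  have hD : t.IsLE D (-1) := by
    refine (hs.isLE_iff D (-1)).2 (fun i hi => ?_)
    obtain rfl | hi : i = 0 ∨ 0 < i := by lia
    · refine HomZero.of_iso (X := M) (Y := D) (fun f => ?_) (Iso.refl _)
        ((shiftFunctorZero T ℤ).symm.app D)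
      obtain ⟨f, rfl⟩ := exists_lift_obj₂ hT f
        (hs.coGT_self _ (isLE_shift_of_le hV.1 1 (by lia)) _)
      obtain ⟨f, rfl⟩ := surj f
      rw [hφ, Category.assoc, hβc, comp_zero]
    · exact (hs.isLE_iff D 0).1 hD₀ i hi
  have hwβ : w ≫ β⟦(1 : ℤ)⟧' = 0 := comp_distTriang_mor_zero₃₁ _ hT
  -- Reducedness splits the triangle, so `D` in `T^{≤ -1}` is a summand of `V'` in `T^{≥ 0}` and
  -- must be zero.
  have hw : w = 0 := hx.shift hD (plus_obj₃ hT hV.plus hV'.plus) w (by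
    rw [← hβ, Functor.map_comp, reassoc_of% hwβ, zero_comp])
  obtain ⟨f, hf⟩ := exists_lift_obj₂ hT (𝟙 D) (by rw [hw, comp_zero])
  have := hV'.2
  rw [t.zero f (-1) 0 (by lia), zero_comp] at hf
  exact (Triangle.isZero₃_iff_isIso₁ _ hT).1 ((IsZero.iff_id_eq_zero D).2 hf.symm)

/-- The coreflection of `X` in the heart. -/
lemma exists_heart_coreflection {X : T} (hX : coGT t (-1 - n) X) :
    ∃ (W : T) (x : W ⟶ X), heartObj t W ∧ IsReduced t x ∧
      ∀ S : T, heartObj t S → ∀ y : S ⟶ X, ∃ z : S ⟶ W, z ≫ x = y := by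
  obtain ⟨N, hN⟩ := hs.exists_finrank_le X
  obtain ⟨P, -, hP, -⟩ := hs.exists_heart_generator
  obtain ⟨V₀, -, x₀, hV₀, -, hx₀⟩ := hs.exists_reduced_quotient hX _ P hP rfl 0
  let R : Set ℕ := {r | ∃ (V : T) (x : V ⟶ X), heartObj t V ∧ IsReduced t x ∧
    Module.finrank k (M ⟶ V) = r}
  have hR : BddAbove R := ⟨N, by rintro _ ⟨V, x, hV, hx, rfl⟩; exact hN V x hV hx⟩
  -- Take `W` of maximal dimension. Reducing `W ⊞ S ⟶ X` cannot enlarge it, so `W` maps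
  -- isomorphically onto the result and `S ⟶ X` factors through `W`.
  obtain ⟨W, x, hW, hx, hWr⟩ := Nat.sSup_mem (s := R) ⟨_, V₀, x₀, hV₀, hx₀, rfl⟩ hR
  refine ⟨W, x, hW, hx, fun S hS y => ?_⟩
  obtain ⟨V', π, x', hV', hπ, hx'⟩ :=
    hs.exists_reduced_quotient hX _ (W ⊞ S) (hW.biprod hS) rfl (biprod.desc x y)
  have hβ : (biprod.inl ≫ π) ≫ x' = x := by rw [Category.assoc, hπ, biprod.inl_desc]
  have := hs.isIso_of_reduced hW hV' hx (biprod.inl ≫ π) x' hβ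
    (hWr ▸ le_csSup hR ⟨V', x', hV', hx', rfl⟩)
  refine ⟨biprod.inr ≫ π ≫ inv (biprod.inl ≫ π), ?_⟩
  have h : inv (biprod.inl ≫ π) ≫ x = x' := by rw [IsIso.inv_comp_eq, hβ]
  rw [Category.assoc, Category.assoc, h, hπ, biprod.inr_desc]

/-- Truncating deeply enough reduces the test objects `Z` to bounded ones, where duality exchanges
maps out of `X` with maps into `X`. -/
lemma coGT_of_homZero {X : T} {c : ℤ}
    (h : ∀ B : T, t.IsLE B c → t.plus B → HomZero B X) : coGT t (c - n) X := by
  intro Z hZ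
  obtain ⟨b, hb⟩ := hs.exists_coGT X
  obtain ⟨A, B, hA, hB, s, p, w, hT⟩ := t.exists_triangle Z (min b (c - n)) _ rfl
  have hA : t.IsLE A (min b (c - n)) := ⟨hA⟩
  have hB : t.IsGE B (min b (c - n) + 1) := ⟨hB⟩
  have hB' : t.IsLE B (c - n) := isLE_obj₃ hT hA hZ (by lia)
  refine HomZero.ext_right hT (hb A (isLE_mono hA (by lia))) ?_
  have h₁ := h (B⟦-n⟧) (isLE_shift_of_le hB' (-n) (by lia)) (t.plus.le_shift (-n) _ ⟨_, hB⟩)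
  rw [hs.homZero_iff _ _ _
    (t.isGE_shift B (min b (c - n) + 1) (-n) (min b (c - n) + 1 + n) (by lia))] at h₁
  exact h₁.of_iso (Iso.refl _) ((shiftFunctorCompIsoId T (-n) n (by lia)).app B)

lemma exists_coGT_succ_of_coGT {X : T} (hX : coGT t (-1 - n) X) [Tfd.IsTriangulated] :
    ∃ (X' : T) (u : X ⟶ X'), Tfd.trW u ∧ coGT t (-n) X' := by
  obtain ⟨W, x, hW, hx, hW'⟩ := hs.exists_heart_coreflection hX
  obtain ⟨X', u, w, hT⟩ := distinguished_cocone_triangle x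
  have hxu : x ≫ u = 0 := comp_distTriang_mor_zero₁₂ _ hT
  have hwx : w ≫ x⟦(1 : ℤ)⟧' = 0 := comp_distTriang_mor_zero₃₁ _ hT
  refine ⟨X', u, (Tfd.trW_iff' u).2 ⟨_, _, _, hT, hs.isGE_le W hW.2⟩, ?_⟩
  rw [← zero_sub]
  refine hs.coGT_of_homZero (fun B hB hB' => ?_)
  obtain ⟨A, S, hA, hS, s, p, w', hT'⟩ := t.exists_triangle B (-1) 0 (by lia)
  have hA : t.IsLE A (-1) := ⟨hA⟩
  have hS : heartObj t S := ⟨isLE_obj₃ hT' hA hB (by lia), ⟨hS⟩⟩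
  have hA' := plus_obj₁ hT' hB' hS.plus
  refine HomZero.ext_left hT' (fun f => ?_) (fun f => ?_)
  · obtain ⟨f, rfl⟩ := exists_lift_obj₂ hT f
      (hx.shift hA hA' _ (by rw [Category.assoc, hwx, comp_zero]))
    obtain ⟨r, hr⟩ := hA'
    rw [hs.homZero_of_isLE hA hr hX f, zero_comp]
  · have hfw : f ≫ w = 0 := by
      -- `V` is the extension of `S` by `W` classified by `f ≫ w`. It lies in the heart, so an
      -- extension of `x` to `V` factors through `W`, and reducedness makes this a splitting.
      obtain ⟨V, i, q, hV⟩ := distinguished_cocone_triangle₂ (f ≫ w)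
      obtain ⟨y, hy⟩ := exists_desc_obj₂ hV x (by rw [Category.assoc, hwx, comp_zero])
      obtain ⟨z, rfl⟩ := hW' V (heartObj.ext hV hW hS) y
      have hiz : i ≫ z = 𝟙 W := by
        rw [← sub_eq_zero]
        exact hx W hW.1 hW.plus _ (by simp [Preadditive.sub_comp, hy])
      have h₀ : (f ≫ w) ≫ i⟦(1 : ℤ)⟧' = 0 := comp_distTriang_mor_zero₃₁ _ hV
      rw [← Category.comp_id (f ≫ w), ← (shiftFunctor T (1 : ℤ)).map_id, ← hiz,
        Functor.map_comp, ← Category.assoc, h₀, zero_comp]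
    obtain ⟨f, rfl⟩ := exists_lift_obj₂ hT f hfw
    obtain ⟨z, rfl⟩ := hW' S hS f
    rw [Category.assoc, hxu, comp_zero]

end SiltingTStructure

end Coreflection

end CYTriple

namespace CYTriple

/-! ### Fundamental representatives and cluster tilting. -/

section ClusterTilting

open Triangulated

variable {k : Type*} [Field k] {T : Type*} [Category* T] [HasZeroObject T] [HasShift T ℤ]
  [Preadditive T] [Linear k T] [∀ i : ℤ, (shiftFunctor T i).Additive]
  [Pretriangulated T] {n : ℤ} {Tfd : ObjectProperty T} {M : T} {t : TStructure T}

namespace SiltingTStructure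

variable (hs : SiltingTStructure k n Tfd M t)

include hs

lemma coGT_of_triangle {A X Z : T} {s : A ⟶ X} {p : X ⟶ Z} {w : Z ⟶ A⟦(1 : ℤ)⟧}
    (hT : Triangle.mk s p w ∈ distTriang T) {c : ℤ} (hX : coGT t c X)
    (hZ : t.IsGE Z (c + n)) : coGT t c A := by
  intro Y hY f
  have hZY : HomZero Z (Y⟦(1 : ℤ)⟧) := (hs.homZero_iff _ _ _ hZ).2 (fun g => by
    have := t.isGE_shift Z (c + n) n c (by lia)
    have : t.IsLE (Y⟦(1 : ℤ)⟧) (c - 1) := isLE_shift_of_le hY 1 (by lia)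
    exact t.zero g (c - 1) c (by lia))
  obtain ⟨g, rfl⟩ := exists_desc_obj₂ hT f (hZY _)
  rw [hX Y hY g, comp_zero]

/-- Up to shift, an object of `T^{≤ -i}` is an extension of one in `T^{≤ -i-1}` by a sum of copies
of `M⟦i⟧`; both receive no maps from `A`. -/
lemma coGT_succ {A : T} {i : ℤ} (h : coGT t (-i - 1) A) (hA : HomZero A (M⟦i⟧)) :
    coGT t (-i) A := by
  intro Z hZ
  obtain ⟨m, Z', p, c, w, hT, hZ'⟩ :=
    hs.exists_add_triangle (X := Z⟦-i⟧) (isLE_shift_of_le hZ _ (by lia))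
  have h₁ : HomZero (A⟦-i⟧) (⨁ fun _ : Fin m => M) :=
    ((homZero_shift_left_iff A M (neg_add_cancel i)).2 hA).of_add_right (add_biproduct M m)
  have h₂ : HomZero (A⟦-i⟧) Z' :=
    (homZero_shift_left_iff A Z' (neg_add_cancel i)).2 (h _ (isLE_shift_of_le hZ' i (by lia)))
  exact (homZero_shift_shift_iff A Z (-i)).1 (HomZero.ext_right hT h₁ h₂)

lemma add_of_coGT {A : T} (hA : t.IsLE A 0) (h : coGT t (-1) A) : add M A := by
  obtain ⟨m, Z, p, c, w, hT, hZ⟩ := hs.exists_add_triangle hA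
  obtain ⟨r, hr⟩ := exists_lift_obj₁ hT (𝟙 A) (h Z hZ _)
  exact ⟨m, ⟨⟨r, p, hr⟩⟩⟩

lemma add_of_homZero {A : T} (hA : t.IsLE A 0) {m : ℕ} (h : coGT t (-m - 1) A)
    (h' : ∀ i : ℤ, 1 ≤ i → i ≤ m → HomZero A (M⟦i⟧)) : add M A := by
  induction m with
  | zero => exact hs.add_of_coGT hA (by simpa using h)
  | succ m ih =>
    refine ih ?_ (fun i hi hi' => h' i hi (by push_cast; lia))
    have := hs.coGT_succ h (h' _ (by push_cast; lia) le_rfl)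
    exact this.mono (by push_cast; lia)

variable [Tfd.IsTriangulated] [IsTriangulated T]

lemma exists_coGT_succ {X : T} {c : ℤ} (hX : coGT t c X) :
    ∃ (X' : T) (u : X ⟶ X'), Tfd.trW u ∧ coGT t (c + 1) X' := by
  -- Shifting by `c + 1 + n` normalizes the bound `c` to `-1 - n`.
  obtain ⟨Y, u, hu, hY⟩ := hs.exists_coGT_succ_of_coGT
    (hX.shift (a := c + 1 + n) (c' := -1 - n) (by lia))
  refine ⟨Y⟦-(c + 1 + n)⟧, (shiftFunctorCompIsoId T (c + 1 + n) (-(c + 1 + n)) (by lia)).inv.app X ≫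
    u⟦-(c + 1 + n)⟧', Tfd.trW.comp_mem _ _ (Tfd.trW_of_isIso _) (hu.shift _), hY.shift (by lia)⟩

lemma exists_coGT_trW (X : T) (c : ℤ) :
    ∃ (X' : T) (u : X ⟶ X'), Tfd.trW u ∧ coGT t c X' := by
  obtain ⟨c₀, hc₀⟩ := hs.exists_coGT X
  have : ∀ m : ℕ, ∃ (X' : T) (u : X ⟶ X'), Tfd.trW u ∧ coGT t (c₀ + m) X' := by
    intro m
    induction m with
    | zero => exact ⟨X, 𝟙 X, Tfd.trW.id_mem X, by simpa using hc₀⟩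
    | succ m ih =>
      obtain ⟨X', u, hu, hX'⟩ := ih
      obtain ⟨X'', u', hu', hX''⟩ := hs.exists_coGT_succ hX'
      exact ⟨X'', u ≫ u', Tfd.trW.comp_mem _ _ hu hu', by
        rwa [Nat.cast_succ, ← add_assoc]⟩
  obtain ⟨X', u, hu, hX'⟩ := this (c - c₀).toNat
  exact ⟨X', u, hu, hX'.mono (by lia)⟩

lemma homZero_quotient {i : ℤ} (hi : 1 ≤ i) (hi' : i ≤ n - 2) :
    HomZero ((quotientFunctor Tfd).obj M) (((quotientFunctor Tfd).obj M)⟦i⟧) := by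
  refine HomZero.of_iso (X := (quotientFunctor Tfd).obj M)
    (Y := (quotientFunctor Tfd).obj (M⟦i⟧)) (fun φ => ?_) (Iso.refl _)
    (((quotientFunctor Tfd).commShiftIso i).app M)
  obtain ⟨f, rfl⟩ := hs.map_surjective hs.isLE_self
    ((hs.coGT_self.shift (a := i) (c' := -1 - i) (by lia)).mono (by lia)) φ
  rw [hs.coGT_self _ (isLE_shift_of_le hs.isLE_self i (by lia)) f, Functor.map_zero]

lemma add_quotient_of_homZero (hn : 2 ≤ n) (X : T) (h : ∀ i : ℤ, 1 ≤ i → i ≤ n - 2 →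
      HomZero ((quotientFunctor Tfd).obj X) (((quotientFunctor Tfd).obj M)⟦i⟧)) :
    add ((quotientFunctor Tfd).obj M) ((quotientFunctor Tfd).obj X) := by
  obtain ⟨X', u, hu, hX'⟩ := hs.exists_coGT_trW X (-(n - 1))
  -- Truncation at `0` preserves the bound because `Z` lies in `T^{≥ 1}` and `1 = -(n - 1) + n`.
  obtain ⟨A, Z, s, c, w, hT, hA, hZ, hZ'⟩ := hs.exists_truncation X' 0
  have := isIso_map_quotientFunctor u hu
  have := isIso_map_quotientFunctor (𝓢 := Tfd) s ⟨_, _, _, hT, hZ'⟩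
  let e : (quotientFunctor Tfd).obj A ≅ (quotientFunctor Tfd).obj X :=
    asIso ((quotientFunctor Tfd).map s) ≪≫ (asIso ((quotientFunctor Tfd).map u)).symm
  refine add_of_iso e (add_map _ (hs.add_of_homZero hA (m := (n - 2).toNat) ?_ ?_))
  · have hA' : coGT t (-(n - 1)) A := hs.coGT_of_triangle hT hX' (by
      convert hZ using 1; lia)
    exact hA'.mono (by lia)
  · intro i hi hi' f
    refine hs.map_injective hA
      ((hs.coGT_self.shift (a := i) (c' := -1 - i) (by lia)).mono (by lia)) f ?_
    exact ((h i hi (by lia)).of_iso e.symm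
      (((quotientFunctor Tfd).commShiftIso i).symm.app M)) _

variable [∀ i : ℤ, (shiftFunctor T i).Linear k] (τ : TraceForm k Tfd n)

include τ in
lemma isClusterTiltingObject (hn : 2 ≤ n) :
    IsClusterTiltingObject (n - 1) ((quotientFunctor Tfd).obj M) := by
  obtain ⟨τ'⟩ := hs.nonempty_traceForm_quotient τ (show n - 1 + 1 = n by lia)
  have zero : ∀ i : ℤ, 1 ≤ i → i ≤ n - 1 - 1 → ∀ X Y : VerdierQuotient Tfd,
      add ((quotientFunctor Tfd).obj M) X → add ((quotientFunctor Tfd).obj M) Y →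
      HomZero X (Y⟦i⟧) := by
    intro i hi hi' X Y hX hY
    refine HomZero.of_add ?_ hX
    rw [← homZero_shift_left_iff _ _ (neg_add_cancel i)]
    refine HomZero.of_add_right ?_ hY
    rw [homZero_shift_left_iff _ _ (neg_add_cancel i)]
    exact hs.homZero_quotient hi (by lia)
  have left : ∀ X : VerdierQuotient Tfd, (∀ i : ℤ, 1 ≤ i → i ≤ n - 1 - 1 →
      HomZero X (((quotientFunctor Tfd).obj M)⟦i⟧)) → add ((quotientFunctor Tfd).obj M) X :=
    fun X h => hs.add_quotient_of_homZero hn X.as.obj (fun i hi hi' => h i hi (by lia))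
  refine ⟨hs.homFinite_quotient.functoriallyFinite_add _, fun X => ⟨?_, ?_⟩, fun X => ⟨?_, ?_⟩⟩
  · exact fun hX i hi hi' Y hY => zero i hi hi' Y X hY hX
  · refine fun h => left X (fun i hi hi' => ?_)
    have h₁ : HomZero ((quotientFunctor Tfd).obj M) (X⟦n - 1 - i⟧) :=
      h (n - 1 - i) (by lia) (by lia) _ (add_self _)
    -- Duality exchanges degree `n - 1 - i` with degree `i`, which reduces to the left orthogonality
    -- condition.
    rw [τ'.homZero_iff trivial] at h₁
    rw [homZero_shift_iff X _ (a' := 0) (b' := i) (by lia)] at h₁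
    exact h₁.of_iso ((shiftFunctorZero _ ℤ).app X) (Iso.refl _)
  · exact fun hX i hi hi' Y hY => zero i hi hi' X Y hX hY
  · exact fun h => left X (fun i hi hi' => h i hi hi' _ (add_self _))

omit [∀ i : ℤ, (shiftFunctor T i).Linear k] in
lemma exists_end_algEquiv (hn : 2 ≤ n) :
    ∃ e : End M ≃ₐ[k] End ((quotientFunctor Tfd).obj M),
      ∀ f : M ⟶ M, e f = (quotientFunctor Tfd).map f := by
  let φ : End M →ₐ[k] End ((quotientFunctor Tfd).obj M) :=
    { toFun := fun f => (quotientFunctor Tfd).map f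
      map_one' := (quotientFunctor Tfd).map_id M
      map_mul' := fun f g => (quotientFunctor Tfd).map_comp g f
      map_zero' := (quotientFunctor Tfd).map_zero M M
      map_add' := fun _ _ => (quotientFunctor Tfd).map_add
      commutes' := fun r => by
        rw [Algebra.algebraMap_eq_smul_one, Algebra.algebraMap_eq_smul_one]
        exact ((quotientFunctor Tfd).map_smul r (𝟙 M)).trans
          (congrArg (r • ·) ((quotientFunctor Tfd).map_id M)) }
  have inj : Function.Injective φ := by
    rw [injective_iff_map_eq_zero]
    exact fun f hf => hs.map_injective hs.isLE_self (hs.coGT_self.mono (by lia)) f hf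
  have surj : Function.Surjective φ := fun f =>
    hs.map_surjective hs.isLE_self (hs.coGT_self.mono (by lia)) f
  exact ⟨AlgEquiv.ofBijective φ ⟨inj, surj⟩, fun f => rfl⟩

end SiltingTStructure

end ClusterTilting

end CYTriple

theorem corollaryC {k : Type*} [Field k] {T : Type*} [Category* T] [HasZeroObject T]
    [HasShift T ℤ] [Preadditive T] [Linear k T] [∀ i : ℤ, (shiftFunctor T i).Additive]
    [∀ i : ℤ, (shiftFunctor T i).Linear k] [Pretriangulated T] [IsTriangulated T]
    (n : ℕ) (hn : 3 ≤ n) (Tfd : ObjectProperty T) [Tfd.IsTriangulated] (M : T)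
    (h : CYTriple.IsCalabiYauTriple k n Tfd (CYTriple.add M)) :
    (CYTriple.HomFinite k (CYTriple.VerdierQuotient Tfd) ∧
      CYTriple.CalabiYau (CYTriple.VerdierQuotient Tfd) k (n - 1)) ∧
    CYTriple.IsClusterTiltingObject (n - 1) ((CYTriple.quotientFunctor Tfd).obj M) ∧
    ∃ e : End M ≃ₐ[k] End ((CYTriple.quotientFunctor Tfd).obj M),
      ∀ f : M ⟶ M, e f = (CYTriple.quotientFunctor Tfd).map f := by
  obtain ⟨t, hs⟩ := h.exists_siltingTStructure
  obtain ⟨τ⟩ := h.relativeCalabiYau.nonempty_traceForm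
  obtain ⟨τ'⟩ := hs.nonempty_traceForm_quotient τ (show (n : ℤ) - 1 + 1 = n by lia)
  exact ⟨⟨hs.homFinite_quotient, τ'.calabiYau hs.homFinite_quotient⟩,
    hs.isClusterTiltingObject τ (by lia), hs.exists_end_algEquiv (by lia)⟩
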